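/- **Setting.** Let $N\ge 1$ agents share a finite nonempty state set $\mathcal S$ and a finite nonempty joint action set $\mathcal A$, transition probabilities $P(s,a,s')$, local rewards $r^i(s,a,s')$ with $|r^i|\le R_{\max}$, and a discount factor $\gamma\in[0,1)$. Let $Q^*$ be the unique solution of $$Q^*(s,a)=\sum_{s'}P(s,a,s')\Big(\tfrac1N\sum_{i=1}^N r^i(s,a,s')+\gamma\max_{a'}Q^*(s',a')\Big).$$ Let $W\in\mathbb R^{N\times N}$ be doubly stochastic, with connected communication graph ($i\ne j$ are linked when $W_{ij}\neq0$ or $W_{ji}\ne 0$), and let $\sigma_2(W)$ be its second largest singular value ($0$ if $N=1$). Let $\beta(a\mid s)$ be a behavior policy, and let $\bar P$ be the transition matrix of the induced chain on $\mathcal S\times\mathcal A$: $\bar P((s,a),(s',a'))=P(s,a,s')\beta(a'\mid s')$. Let $d$ be a stationary distribution of $\bar P$ with all entries positive, $d_{\min}=\min d$, $d_{\max}=\max d$. Let $(s_k,a_k)_{k\ge0}$ be a Markov chain with transition matrix $\bar P$ (any initial law) with respect to a filtration $(\mathcal F_k)$. Starting from $\mathcal F_0$-measurable tables with $\|Q^i_0\|_\infty\le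 R_{\max}/(1-\gamma)$, run distributed Q-learning with step size $\alpha>0$: $$Q^i_{k+1}(s,a)=\sum_{j}W_{ij}Q^j_k(s,a)+\mathbf 1_{\{(s,a)=(s_k,a_k)\}}\,\alpha\Big(r^i(s_k,a_k,s_{k+1})+\gamma\max_{a'}Q^i_k(s_{k+1},a')-Q^i_k(s_k,a_k)\Big),$$ and put $Q^{\mathrm{avg}}_k=\frac1N\sum_iQ^i_k$. Let $\tau\ge1$ be an integer such that $d_{\mathrm{TV}}(\bar P^{\tau}(x,\cdot),d)\le\alpha$ for every $x\in\mathcal S\times\mathcal A$ (for example the mixing time of the chain at level $\alpha$). **Theorem.** There are an absolute constant $C>0$ and a function $B$ such that, in every such setting, if $\alpha\le\min\{\min_iW_{ii},\frac1{2\tau}\}$ and $k\ge\tau$, then $\|Q^{\mathrm{avg}}_k-Q^*\|_\infty$ is integrable and $$\mathbb E\|Q^{\mathrm{avg}}_k-Q^*\|_\infty\le B\Big((1-\alpha(1-\gamma)d_{\min})^{\frac{k-\tau}2}+\sigma_2(W)^{\frac{k-\tau}4}\Big)$$ $$\qquad+\,C\left(\sqrt{\ln(2\tau|\mathcal S||\mathcal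 A|)}\;\frac{\alpha^{1/2}d_{\max}\sqrt{\tau}\,R_{\max}}{(1-\gamma)^{5/2}d_{\min}^{3/2}}+\frac{\alpha R_{\max}d_{\max}\sqrt{N|\mathcal S||\mathcal A|}}{(1-\gamma)^3d_{\min}^2(1-\sigma_2(W))}\right),$$ where $B=B(N,|\mathcal S|,|\mathcal A|,\gamma,R_{\max},d_{\min},\sigma_2(W))$ does not depend on $k$, $\alpha$, $\tau$, the initial tables or the trajectory law (and $0^0=1$). -/

import Mathlib

open MeasureTheory ProbabilityTheory

namespace DistQ

noncomputable section

/-- A discounted multi-agent Markov decision process with `N` agents, state set `S` and joint action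
set `A` (for instance a product of individual action sets). `P s a s'` is the probability of moving
from `s` to `s'` under the joint action `a`, and `r i s a s'` is the local reward of agent `i`. -/
structure MAMDP (N : ℕ) (S A : Type*) [Fintype S] where
  P : S → A → S → ℝ
  P_nonneg : ∀ s a s', 0 ≤ P s a s'
  P_sum : ∀ s a, ∑ s', P s a s' = 1
  r : Fin N → S → A → S → ℝ
  γ : ℝ
  γ_nonneg : 0 ≤ γ
  γ_lt_one : γ < 1

variable {N : ℕ} {S A : Type*} [Fintype S] [Fintype A]

/-- Bellman optimality operator for the reward averaged over the agents. -/
def bellman (M : MAMDP N S A) (Q : S × A → ℝ) : S × A → ℝ := fun x =>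
  ∑ s', M.P x.1 x.2 s' * ((1 / (N : ℝ)) * ∑ i, M.r i x.1 x.2 s' + M.γ * ⨆ a, Q (s', a))

theorem abs_iSup_sub_iSup_le [Nonempty A] (f g : A → ℝ) (c : ℝ) (h : ∀ a, |f a - g a| ≤ c) :
    |(⨆ a, f a) - ⨆ a, g a| ≤ c := by
  have hf : BddAbove (Set.range f) := Set.finite_range f |>.bddAbove
  have hg : BddAbove (Set.range g) := Set.finite_range g |>.bddAbove
  rw [abs_le]
  constructor
  · have : (⨆ a, g a) ≤ (⨆ a, f a) + c :=
      ciSup_le fun a => by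
        have h1 := le_ciSup hf a
        have h2 := (abs_le.1 (h a)).1
        linarith
    linarith
  · have : (⨆ a, f a) ≤ (⨆ a, g a) + c :=
      ciSup_le fun a => by
        have h1 := le_ciSup hg a
        have h2 := (abs_le.1 (h a)).2
        linarith
    linarith

theorem bellman_contracting [Nonempty A] (M : MAMDP N S A) :
    ContractingWith (⟨M.γ, M.γ_nonneg⟩ : NNReal) (bellman M) := by
  refine ⟨?_, LipschitzWith.of_dist_le_mul fun Q Q' => ?_⟩
  · exact_mod_cast M.γ_lt_one
  · have hγ := M.γ_nonneg
    refine (dist_pi_le_iff (mul_nonneg hγ dist_nonneg)).2 fun x => ?_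
    have hs : ∀ s', |(⨆ a, Q (s', a)) - ⨆ a, Q' (s', a)| ≤ dist Q Q' := fun s' =>
      abs_iSup_sub_iSup_le _ _ _ fun a => by
        rw [← Real.dist_eq]; exact dist_le_pi_dist Q Q' (s', a)
    rw [Real.dist_eq]
    have : bellman M Q x - bellman M Q' x =
        ∑ s', M.P x.1 x.2 s' * (M.γ * ((⨆ a, Q (s', a)) - ⨆ a, Q' (s', a))) := by
      simp only [bellman, ← Finset.sum_sub_distrib]
      exact Finset.sum_congr rfl fun s' _ => by ring
    rw [this]
    calc |∑ s', M.P x.1 x.2 s' * (M.γ * ((⨆ a, Q (s', a)) - ⨆ a, Q' (s', a)))|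
        ≤ ∑ s', |M.P x.1 x.2 s' * (M.γ * ((⨆ a, Q (s', a)) - ⨆ a, Q' (s', a)))| :=
          Finset.abs_sum_le_sum_abs _ _
      _ ≤ ∑ s', M.P x.1 x.2 s' * (M.γ * dist Q Q') := by
          refine Finset.sum_le_sum fun s' _ => ?_
          rw [abs_mul, abs_mul, abs_of_nonneg hγ, abs_of_nonneg (M.P_nonneg _ _ _)]
          exact mul_le_mul_of_nonneg_left (mul_le_mul_of_nonneg_left (hs s') hγ)
            (M.P_nonneg _ _ _)
      _ = M.γ * dist Q Q' := by rw [← Finset.sum_mul, M.P_sum, one_mul]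

/-- The optimal Q-function of the averaged reward: the solution of the Bellman optimality equation. -/
def optimalQ [Nonempty A] (M : MAMDP N S A) : S × A → ℝ :=
  (bellman_contracting M).fixedPoint

theorem bellman_optimalQ [Nonempty A] (M : MAMDP N S A) :
    bellman M (optimalQ M) = optimalQ M :=
  (bellman_contracting M).fixedPoint_isFixedPt

theorem eq_optimalQ [Nonempty A] (M : MAMDP N S A) (Q : S × A → ℝ) (h : bellman M Q = Q) :
    Q = optimalQ M :=
  (bellman_contracting M).fixedPoint_unique h

/-- One step of distributed Q-learning: all tables are mixed with the weights `W`, and at the visited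
pair `x` agent `i` adds its temporal-difference error for the observed next state `s'`. -/
def qStep [DecidableEq S] [DecidableEq A] (M : MAMDP N S A) (W : Matrix (Fin N) (Fin N) ℝ) (α : ℝ)
    (Q : Fin N → S × A → ℝ) (x : S × A) (s' : S) : Fin N → S × A → ℝ := fun i y =>
  ∑ j, W i j * Q j y +
    if y = x then α * (M.r i x.1 x.2 s' + M.γ * (⨆ a, Q i (s', a)) - Q i x) else 0

/-- The iterates `Q^i_k` of distributed Q-learning along a trajectory `x k = (s_k, a_k)`. -/
def qIter [DecidableEq S] [DecidableEq A] (M : MAMDP N S A) (W : Matrix (Fin N) (Fin N) ℝ) (α : ℝ)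
    (Q₀ : Fin N → S × A → ℝ) (x : ℕ → S × A) : ℕ → Fin N → S × A → ℝ
  | 0 => Q₀
  | k + 1 => qStep M W α (qIter M W α Q₀ x k) (x k) (x (k + 1)).1

/-- The average over the agents. -/
def avg (Q : Fin N → S × A → ℝ) : S × A → ℝ := fun x => (1 / (N : ℝ)) * ∑ i, Q i x

/-- `β s a` is the probability that the behavior policy selects `a` in state `s`. -/
structure IsPolicy (β : S → A → ℝ) : Prop where
  nonneg : ∀ s a, 0 ≤ β s a
  sum_eq_one : ∀ s, ∑ a, β s a = 1

/-- Transition matrix of the state-action chain induced by the behavior policy `β`. -/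
def saMatrix (M : MAMDP N S A) (β : S → A → ℝ) : Matrix (S × A) (S × A) ℝ :=
  fun x y => M.P x.1 x.2 y.1 * β y.1 y.2

/-- `d` is a stationary distribution of the transition matrix `K`, charging every point. -/
structure IsPosStationary {X : Type*} [Fintype X] (K : Matrix X X ℝ) (d : X → ℝ) : Prop where
  pos : ∀ x, 0 < d x
  sum_eq_one : ∑ x, d x = 1
  stationary : Matrix.vecMul d K = d

/-- Total variation distance of two distributions on a finite set. -/
def tvDist {X : Type*} [Fintype X] (p q : X → ℝ) : ℝ := (1 / 2) * ∑ x, |p x - q x|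

/-- After `t` steps the chain `K` is, from every starting point, within `c` of `d` in total
variation. The mixing time at level `c` is the least such `t`. -/
def MixedAt {X : Type*} [Fintype X] [DecidableEq X] (K : Matrix X X ℝ) (d : X → ℝ) (c : ℝ)
    (t : ℕ) : Prop := ∀ x, tvDist ((K ^ t) x) d ≤ c

/-- `X` is a Markov chain with transition matrix `K` with respect to the filtration `ℱ`. -/
structure IsMarkovChain {X Ω : Type*} {m : MeasurableSpace Ω} (μ : Measure Ω)
    (ℱ : Filtration ℕ m) (K : Matrix X X ℝ) (Z : ℕ → Ω → X) : Prop where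
  adapted : ∀ k x, MeasurableSet[ℱ k] {ω | Z k ω = x}
  markov : ∀ k y, μ⟦{ω | Z (k + 1) ω = y} | ℱ k⟧ =ᵐ[μ] fun ω => K (Z k ω) y

/-- Communication graph of the weight matrix: `i` and `j` are linked when `W i j` or `W j i` is
nonzero. -/
def commGraph (W : Matrix (Fin N) (Fin N) ℝ) : SimpleGraph (Fin N) :=
  SimpleGraph.fromRel fun i j => W i j ≠ 0

/-- Second largest singular value (with multiplicity; Mathlib counts from `0`). It is `0` when there
is only one agent. -/
def sigma2 (W : Matrix (Fin N) (Fin N) ℝ) : ℝ :=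
  (Matrix.toEuclideanLin W).singularValues 1

end

end DistQ

/-! Write `E` for the error of the averaged table. Double stochasticity makes the mixing step
invisible to the average, so `E` follows asynchronous Q-learning perturbed only by `consensusError`,
which measures how far the agents disagree. All tables stay bounded by `R / (1 - γ)`, because `α ≤ W
i i` keeps the mixing weights nonnegative after the update has taken `α` from the diagonal.

Disagreement: on zero-sum vectors `W` contracts the Euclidean norm by `sigma2 W < 1`
(`sigma2_spec`), so the centered tables decay geometrically down to a level of order `α / (1 - σ₂)`
(`abs_qIter_sub_avg_le`).

Markovian noise: the update hits coordinate `y` with the indicator of `y = x k` instead of its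
stationary mean `d y`. The truncated Poisson solution, a sum over `t < τ`, rewrites the difference
as a martingale increment, a telescoping term and a remainder of size at most `2α` by mixing. The
martingale increments, together with the sampling noise of the next state, are accumulated in
`noiseSum`, a linear recursion with rate `α * d y` in each coordinate. What remains after removing
`noiseSum` and adding the Poisson boundary term, `corrected`, contracts pathwise in sup norm with
factor `1 - α (1 - γ) dmin` (`norm_corrected_succ_le`).

Size of the noise: martingale orthogonality gives a recursion for the second moment summed over all
coordinates. The Poisson increments cost only order `τ` per step up to a telescoping potential, with
no factor for the number of state-action pairs (`integral_sum_sq_poisson_sub_le`). Hence the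
expected sup norm of `noiseSum` is of order `√(α τ / dmin)`, obtained without any union bound; of
the logarithm in the theorem only a positive lower bound is needed.

Solving the recursion for `corrected` gives the bias and both error terms
(`integral_norm_error_le`). The term linear in `α τ` is absorbed into the square-root term, falling
back on the trivial bound `2 R / (1 - γ)` when the latter is large (`error_terms_le`). -/

namespace DistQ

/-! ### Spectral gap of the weight matrix on zero-sum vectors. -/

section Spectral

variable {N : ℕ} {W : Matrix (Fin N) (Fin N) ℝ}

/-- The variance of `v` under the weights `w` as half the mean squared difference of two independent
copies. -/
theorem sum_mul_sq_sub_sq_sum {ι : Type*} [Fintype ι] (w v : ι → ℝ) (hw : ∑ j, w j = 1) :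
    ∑ j, w j * v j ^ 2 - (∑ j, w j * v j) ^ 2 =
      (1 / 2) * ∑ j, ∑ l, w j * w l * (v j - v l) ^ 2 := by
  have h1 : ∀ j, ∑ l, w j * w l * (v j - v l) ^ 2 =
      w j * v j ^ 2 - 2 * (w j * v j) * (∑ l, w l * v l) + w j * ∑ l, w l * v l ^ 2 := by
    intro j
    calc ∑ l, w j * w l * (v j - v l) ^ 2
        = ∑ l, (w j * v j ^ 2 * w l - 2 * (w j * v j) * (w l * v l) + w j * (w l * v l ^ 2)) :=
          Finset.sum_congr rfl fun l _ => by ring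
      _ = _ := by
          rw [Finset.sum_add_distrib, Finset.sum_sub_distrib, ← Finset.mul_sum, ← Finset.mul_sum,
            ← Finset.mul_sum, hw, mul_one]
  simp_rw [h1]
  rw [Finset.sum_add_distrib, Finset.sum_sub_distrib, ← Finset.sum_mul, ← Finset.sum_mul,
    ← Finset.mul_sum, hw]
  ring

/-- The column sums turn `‖v‖ ^ 2` into a sum of second moments over the rows of `W`; the defect is
then a sum of row variances. -/
theorem norm_sq_sub_norm_sq_toEuclideanLin (hW : W ∈ doublyStochastic ℝ (Fin N))
    (v : EuclideanSpace ℝ (Fin N)) :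
    ‖v‖ ^ 2 - ‖Matrix.toEuclideanLin W v‖ ^ 2 =
      (1 / 2) * ∑ i, ∑ j, ∑ l, W i j * W i l * (v j - v l) ^ 2 := by
  have happ : ∀ i, Matrix.toEuclideanLin W v i = ∑ j, W i j * v j := fun i => by
    simp [Matrix.toLpLin_apply, Matrix.mulVec, dotProduct]
  have h2 : ∑ j, v j ^ 2 = ∑ i, ∑ j, W i j * v j ^ 2 := by
    rw [Finset.sum_comm]
    exact Finset.sum_congr rfl fun j _ => by
      rw [← Finset.sum_mul, sum_col_of_mem_doublyStochastic hW, one_mul]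
  rw [EuclideanSpace.real_norm_sq_eq, EuclideanSpace.real_norm_sq_eq, h2, ← Finset.sum_sub_distrib,
    Finset.mul_sum]
  refine Finset.sum_congr rfl fun i _ => ?_
  rw [happ, sum_mul_sq_sub_sq_sum _ _ (sum_row_of_mem_doublyStochastic hW i)]

/-- If no norm is lost, every term of the row-variance formula vanishes. The positive diagonal makes
this usable along single edges, and connectedness propagates the equality. -/
theorem eq_of_norm_toEuclideanLin_ge (hW : W ∈ doublyStochastic ℝ (Fin N))
    (hconn : (commGraph W).Connected) (hdiag : ∀ i, 0 < W i i)
    (v : EuclideanSpace ℝ (Fin N)) (hv : ‖v‖ ^ 2 ≤ ‖Matrix.toEuclideanLin W v‖ ^ 2) (i j : Fin N) :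
    v i = v j := by
  have h0 := fun i j => nonneg_of_mem_doublyStochastic hW (i := i) (j := j)
  have hn : ∀ i j l, 0 ≤ W i j * W i l * (v j - v l) ^ 2 := fun i j l =>
    mul_nonneg (mul_nonneg (h0 _ _) (h0 _ _)) (sq_nonneg _)
  have hz : ∀ i l, W i l ≠ 0 → v i = v l := by
    intro i l hil
    by_contra hne
    -- The term `j = i` of the triple sum: `W i i > 0` lets the edge from `i` to `l` be seen
    -- directly.
    have hpos : 0 < W i i * W i l * (v i - v l) ^ 2 :=
      mul_pos (mul_pos (hdiag i) (lt_of_le_of_ne (h0 _ _) hil.symm))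
        (by have := sub_ne_zero.2 hne; positivity)
    have : 0 < ∑ i, ∑ j, ∑ l, W i j * W i l * (v j - v l) ^ 2 :=
      calc _ < _ := hpos
        _ ≤ ∑ l, W i i * W i l * (v i - v l) ^ 2 :=
          Finset.single_le_sum (fun l _ => hn i i l) (Finset.mem_univ l)
        _ ≤ ∑ j, ∑ l, W i j * W i l * (v j - v l) ^ 2 :=
          Finset.single_le_sum (f := fun j => ∑ l, W i j * W i l * (v j - v l) ^ 2)
            (fun j _ => Finset.sum_nonneg fun l _ => hn i j l) (Finset.mem_univ i)
        _ ≤ _ := Finset.single_le_sum (f := fun i => ∑ j, ∑ l, W i j * W i l * (v j - v l) ^ 2)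
            (fun i _ => Finset.sum_nonneg fun j _ => Finset.sum_nonneg fun l _ => hn i j l)
            (Finset.mem_univ i)
    have := norm_sq_sub_norm_sq_toEuclideanLin hW v
    linarith
  obtain ⟨p⟩ := hconn.preconnected i j
  induction p with
  | nil => rfl
  | cons h _ ih =>
    refine Eq.trans ?_ ih
    rw [commGraph, SimpleGraph.fromRel_adj] at h
    rcases h.2 with h | h
    · exact hz _ _ h
    · exact (hz _ _ h).symm

theorem sigma2_nonneg (W : Matrix (Fin N) (Fin N) ℝ) : 0 ≤ sigma2 W :=
  LinearMap.singularValues_nonneg _ _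

/-- Diagonalize `T* T`. Eigenvectors with eigenvalue at least `1` are constant vectors, so only one
orthonormal eigenvector can have such an eigenvalue; the all-ones vector is fixed, hence spans that
direction, and zero-sum vectors see only eigenvalues up to `σ₂ ^ 2`. -/
theorem sigma2_spec (hW : W ∈ doublyStochastic ℝ (Fin N))
    (hconn : (commGraph W).Connected) (hdiag : ∀ i, 0 < W i i) :
    sigma2 W < 1 ∧ ∀ v : EuclideanSpace ℝ (Fin N), ∑ i, v i = 0 →
      ‖Matrix.toEuclideanLin W v‖ ≤ sigma2 W * ‖v‖ := by
  have hne : Nonempty (Fin N) := hconn.nonempty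
  have hrank : Module.finrank ℝ (EuclideanSpace ℝ (Fin N)) = N := by simp
  rcases Nat.lt_or_ge 1 N with hN | hN
  swap
  · have hN1 : N = 1 := le_antisymm hN (Fin.pos_iff_nonempty.2 hne)
    subst hN1
    have h0 : sigma2 W = 0 := LinearMap.singularValues_of_finrank_le _ (by simp)
    rw [h0]
    refine ⟨one_pos, fun v hv => ?_⟩
    have : v = 0 := by
      ext i
      fin_cases i
      simpa using hv
    simp [this]
  set T := Matrix.toEuclideanLin W with hT
  have hS := T.isSymmetric_adjoint_comp_self
  set l := hS.eigenvalues hrank with hl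
  set b := hS.eigenvectorBasis hrank with hb
  let i0 : Fin N := ⟨0, by omega⟩
  let i1 : Fin N := ⟨1, hN⟩
  have hsig : sigma2 W ^ 2 = l i1 := T.sq_singularValues_of_lt hrank hN
  have happ : ∀ i, (LinearMap.adjoint T ∘ₗ T) (b i) = l i • b i := fun i =>
    hS.apply_eigenvectorBasis hrank i
  have hnorm : ∀ i, ‖T (b i)‖ ^ 2 = l i := by
    intro i
    have h1 : inner ℝ (b i) ((LinearMap.adjoint T ∘ₗ T) (b i)) = ‖T (b i)‖ ^ 2 := by
      rw [LinearMap.comp_apply, LinearMap.adjoint_inner_right, real_inner_self_eq_norm_sq]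
    rw [← h1, happ, inner_smul_right, real_inner_self_eq_norm_sq, b.norm_eq_one]
    ring
  have hconst : ∀ i, 1 ≤ l i → ∀ p q, b i p = b i q := fun i hi =>
    eq_of_norm_toEuclideanLin_ge hW hconn hdiag _ (by
      rw [b.norm_eq_one, ← hT, hnorm]; simpa using hi)
  have hanti : Antitone l := hS.eigenvalues_antitone hrank
  -- Otherwise the two leading eigenvectors are both constant and orthogonal, so one of them is
  -- zero.
  have hl1 : l i1 < 1 := by
    by_contra! h
    have h0 : 1 ≤ l i0 := h.trans (hanti (by simp [i0, i1, Fin.le_def]))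
    have horth : inner ℝ (b i0) (b i1) = 0 :=
      b.orthonormal.2 (by simp [i0, i1])
    have c0 : ∀ p, b i0 p = b i0 i0 := fun p => hconst _ h0 _ _
    have c1 : ∀ p, b i1 p = b i1 i0 := fun p => hconst _ h _ _
    have hprod : (N : ℝ) * (b i0 i0 * b i1 i0) = 0 := by
      rw [← horth, PiLp.inner_apply]
      simp [c0, c1, mul_comm]
    have hNpos : (N : ℝ) ≠ 0 := by positivity
    rcases mul_eq_zero.1 ((mul_eq_zero.1 hprod).resolve_left hNpos) with hz | hz
    · have : b i0 = 0 := by ext p; simp [c0 p, hz]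
      have h1 := b.norm_eq_one i0
      simp [this] at h1
    · have : b i1 = 0 := by ext p; simp [c1 p, hz]
      have h1 := b.norm_eq_one i1
      simp [this] at h1
  have hslt : sigma2 W < 1 := by
    have := sigma2_nonneg W
    nlinarith
  refine ⟨hslt, fun v hv => ?_⟩
  let e : EuclideanSpace ℝ (Fin N) := WithLp.toLp 2 1
  have hev : ∀ w : EuclideanSpace ℝ (Fin N), inner ℝ e w = ∑ i, w i := fun w => by
    simp [e, PiLp.inner_apply]
  have hTe : T e = e := by
    ext i
    simp [hT, e, Matrix.toLpLin_apply, mulVec_one_of_mem_doublyStochastic hW]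
  have hTsum : ∀ w, inner ℝ e (T w) = inner ℝ e w := by
    intro w
    rw [hev, hev]
    have := sum_mulVec_of_mem_doublyStochastic (x := w) hW
    simpa [hT, Matrix.toLpLin_apply] using this
  have hSe : ∀ w, inner ℝ e ((LinearMap.adjoint T ∘ₗ T) w) = inner ℝ e w := by
    intro w
    rw [LinearMap.comp_apply, LinearMap.adjoint_inner_right, hTe, hTsum]
  -- Pairing with the fixed vector `e` multiplies by `l i` and also by `1`; since `l i < 1`, the
  -- pairing is zero.
  have hperp : ∀ i, i ≠ i0 → inner ℝ e (b i) = 0 := by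
    intro i hi
    have hle : l i ≤ l i1 := hanti (by
      rw [Fin.le_def]; have : (i : ℕ) ≠ 0 := fun h => hi (Fin.ext h)
      simp [i1]; omega)
    have h1 := hSe (b i)
    rw [happ, inner_smul_right] at h1
    have h2 : (1 - l i) * inner ℝ e (b i) = 0 := by linarith
    exact (mul_eq_zero.1 h2).resolve_left (by linarith)
  -- By `hperp`, `e` is a multiple of `b i0`, and a nonzero one because `‖e‖ ^ 2 = N`.
  have hb0 : inner ℝ (b i0) v = 0 := by
    have h1 : inner ℝ e v = inner ℝ e (b i0) * inner ℝ (b i0) v := by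
      rw [← b.sum_inner_mul_inner e v]
      exact Finset.sum_eq_single i0 (fun i _ hi => by rw [hperp i hi, zero_mul]) (by simp)
    have h2 : inner ℝ e e = inner ℝ e (b i0) * inner ℝ (b i0) e := by
      rw [← b.sum_inner_mul_inner e e]
      exact Finset.sum_eq_single i0 (fun i _ hi => by rw [hperp i hi, zero_mul]) (by simp)
    rw [hev, hv] at h1
    refine (mul_eq_zero.1 h1.symm).resolve_left fun h => ?_
    rw [h, zero_mul, hev] at h2
    simp [e] at h2
    omega
  have hcoord : ∀ i, inner ℝ (b i) ((LinearMap.adjoint T ∘ₗ T) v) = l i * inner ℝ (b i) v := by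
    intro i
    rw [← hS (b i) v, happ, inner_smul_left]
    simp
  have hkey : ‖T v‖ ^ 2 ≤ l i1 * ‖v‖ ^ 2 := by
    have h1 : ‖T v‖ ^ 2 = ∑ i, l i * inner ℝ (b i) v ^ 2 := by
      rw [← real_inner_self_eq_norm_sq, ← LinearMap.adjoint_inner_right, ← LinearMap.comp_apply,
        ← b.sum_inner_mul_inner]
      refine Finset.sum_congr rfl fun i _ => ?_
      rw [hcoord, real_inner_comm]
      ring
    have h2 : ‖v‖ ^ 2 = ∑ i, inner ℝ (b i) v ^ 2 := by
      rw [← real_inner_self_eq_norm_sq, ← b.sum_inner_mul_inner]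
      refine Finset.sum_congr rfl fun i _ => ?_
      rw [real_inner_comm]
      ring
    rw [h1, h2, Finset.mul_sum]
    refine Finset.sum_le_sum fun i _ => ?_
    by_cases hi : i = i0
    · rw [hi, hb0]; simp
    · refine mul_le_mul_of_nonneg_right (hanti ?_) (sq_nonneg _)
      rw [Fin.le_def]
      have : (i : ℕ) ≠ 0 := fun h => hi (Fin.ext h)
      simp [i1]; omega
  refine abs_le_of_sq_le_sq' ?_ (mul_nonneg (sigma2_nonneg W) (norm_nonneg _)) |>.2
  rw [mul_pow, hsig]
  exact hkey

end Spectral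

/-! ### Pathwise bounds: boundedness of the tables and consensus. -/

section Path

variable {N : ℕ} {S A : Type*}

theorem abs_iSup_le_of_abs_le [Fintype A] [Nonempty A] (f : A → ℝ) (c : ℝ) (h : ∀ a, |f a| ≤ c) :
    |⨆ a, f a| ≤ c := by
  simpa using abs_iSup_sub_iSup_le f (fun _ => 0) c (by simpa using h)

theorem abs_mean_le (hN : N ≠ 0) (f : Fin N → ℝ) (c : ℝ) (h : ∀ i, |f i| ≤ c) :
    |(1 / (N : ℝ)) * ∑ i, f i| ≤ c := by
  have hNpos : (0 : ℝ) < N := by positivity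
  rw [abs_mul, abs_of_nonneg (by positivity), one_div, inv_mul_le_iff₀ hNpos]
  calc |∑ i, f i| ≤ ∑ i, |f i| := Finset.abs_sum_le_sum_abs _ _
    _ ≤ ∑ _i : Fin N, c := Finset.sum_le_sum fun i _ => h i
    _ = N * c := by simp

theorem abs_avg_le (hN : N ≠ 0) (Q : Fin N → S × A → ℝ) (c : ℝ) (x : S × A)
    (h : ∀ i, |Q i x| ≤ c) : |avg Q x| ≤ c :=
  abs_mean_le hN _ c h

/-- The vector of deviations of `f` from its mean. -/
noncomputable def centered (f : Fin N → ℝ) : EuclideanSpace ℝ (Fin N) :=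
  WithLp.toLp 2 fun i => f i - (1 / (N : ℝ)) * ∑ j, f j

theorem sum_centered (hN : N ≠ 0) (f : Fin N → ℝ) : ∑ i, centered f i = 0 := by
  have hNpos : (N : ℝ) ≠ 0 := by positivity
  simp only [centered, Finset.sum_sub_distrib, Finset.sum_const, Finset.card_univ,
    Fintype.card_fin, nsmul_eq_mul]
  field_simp
  ring

/-- Subtracting the mean is an orthogonal projection, so it does not increase the Euclidean norm. -/
theorem norm_centered_le (hN : N ≠ 0) (f : Fin N → ℝ) (c : ℝ) (h : ∀ i, |f i| ≤ c) :
    ‖centered f‖ ≤ √N * c := by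
  have hNpos : (N : ℝ) ≠ 0 := by positivity
  have hc : 0 ≤ c := (abs_nonneg _).trans (h ⟨0, Nat.pos_of_ne_zero hN⟩)
  rw [EuclideanSpace.norm_eq, ← Real.sqrt_sq hc, ← Real.sqrt_mul (by positivity)]
  refine Real.sqrt_le_sqrt ?_
  set m := (1 / (N : ℝ)) * ∑ j, f j with hm
  have hs : ∑ j, f j = N * m := by rw [hm]; field_simp
  calc ∑ i, ‖centered f i‖ ^ 2 = ∑ i, (f i ^ 2 - 2 * m * f i + m ^ 2) :=
        Finset.sum_congr rfl fun i _ => by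
          rw [Real.norm_eq_abs, sq_abs]
          simp only [centered, ← hm]
          ring
    _ = ∑ i, f i ^ 2 - N * m ^ 2 := by
        rw [Finset.sum_add_distrib, Finset.sum_sub_distrib, ← Finset.mul_sum, hs]
        simp
        ring
    _ ≤ ∑ i, f i ^ 2 := by
        have : 0 ≤ (N : ℝ) * m ^ 2 := by positivity
        linarith
    _ ≤ ∑ _i : Fin N, c ^ 2 := Finset.sum_le_sum fun i _ => sq_le_sq' (abs_le.1 (h i)).1
        (abs_le.1 (h i)).2
    _ = N * c ^ 2 := by simp

theorem avg_qStep [Fintype S] [DecidableEq S] [DecidableEq A] (M : MAMDP N S A)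
    {W : Matrix (Fin N) (Fin N) ℝ} (hW : W ∈ doublyStochastic ℝ (Fin N)) (α : ℝ)
    (Q : Fin N → S × A → ℝ) (x : S × A) (s' : S) (y : S × A) :
    avg (qStep M W α Q x s') y = avg Q y + if y = x then
      α * ((1 / (N : ℝ)) * ∑ i, (M.r i x.1 x.2 s' + M.γ * (⨆ a, Q i (s', a)) - Q i x)) else 0 := by
  have h : ∑ i, ∑ j, W i j * Q j y = ∑ j, Q j y := by
    rw [Finset.sum_comm]
    exact Finset.sum_congr rfl fun j _ => by
      rw [← Finset.sum_mul, sum_col_of_mem_doublyStochastic hW, one_mul]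
  unfold avg qStep
  rw [Finset.sum_add_distrib, h, mul_add]
  congr 1
  by_cases hy : y = x
  · simp only [hy, if_true]
    rw [← Finset.mul_sum]
    ring
  · simp [hy]

/-- The averaged temporal-difference target at the pair `x` when the next state is `s'`. -/
noncomputable def tdTarget [Fintype S] (M : MAMDP N S A) (q : S × A → ℝ) (x : S × A) (s' : S) : ℝ :=
  (1 / (N : ℝ)) * ∑ i, M.r i x.1 x.2 s' + M.γ * ⨆ a, q (s', a)

/-- The effect of disagreement between the agents on the averaged temporal-difference error. -/
noncomputable def consensusError [Fintype S] (M : MAMDP N S A) (Q : Fin N → S × A → ℝ)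
    (s' : S) : ℝ :=
  M.γ * ((1 / (N : ℝ)) * ∑ i, ((⨆ a, Q i (s', a)) - ⨆ a, avg Q (s', a)))

/-- The maximum is not linear, so the average of the agents' targets differs from the target of the
average; `consensusError` is exactly this gap. -/
theorem avg_qStep_eq [Fintype S] [DecidableEq S] [DecidableEq A] (M : MAMDP N S A) (hN : N ≠ 0)
    {W : Matrix (Fin N) (Fin N) ℝ} (hW : W ∈ doublyStochastic ℝ (Fin N)) (α : ℝ)
    (Q : Fin N → S × A → ℝ) (x : S × A) (s' : S) (y : S × A) :
    avg (qStep M W α Q x s') y = avg Q y + if y = x then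
      α * (tdTarget M (avg Q) x s' - avg Q x + consensusError M Q s') else 0 := by
  have hNpos : (N : ℝ) ≠ 0 := by positivity
  rw [avg_qStep M hW]
  congr 2
  rw [tdTarget, consensusError]
  simp only [Finset.sum_sub_distrib, Finset.sum_add_distrib, ← Finset.mul_sum, Finset.sum_const,
    Finset.card_univ, Fintype.card_fin, nsmul_eq_mul]
  conv_rhs => rw [show avg Q x = (1 / (N : ℝ)) * ∑ i, Q i x from rfl]
  field_simp
  ring

variable [Fintype S] [Fintype A]

theorem abs_td_error_le [Nonempty A] (M : MAMDP N S A) {R : ℝ} (i : Fin N)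
    (hr : ∀ s a s', |M.r i s a s'| ≤ R) (q : S × A → ℝ)
    (hq : ∀ x, |q x| ≤ R / (1 - M.γ)) (x : S × A) (s' : S) :
    |M.r i x.1 x.2 s' + M.γ * ⨆ a, q (s', a)| ≤ R / (1 - M.γ) := by
  have h1 : 0 < 1 - M.γ := by linarith [M.γ_lt_one]
  have h2 : |M.γ * ⨆ a, q (s', a)| ≤ M.γ * (R / (1 - M.γ)) := by
    rw [abs_mul, abs_of_nonneg M.γ_nonneg]
    exact mul_le_mul_of_nonneg_left (abs_iSup_le_of_abs_le _ _ fun a => hq _) M.γ_nonneg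
  have h3 : R + M.γ * (R / (1 - M.γ)) = R / (1 - M.γ) := by field_simp; ring
  exact (abs_add_le _ _).trans (by linarith [hr x.1 x.2 s'])

theorem abs_tdTarget_le [Nonempty A] (M : MAMDP N S A) (hN : N ≠ 0) {R : ℝ}
    (hr : ∀ i s a s', |M.r i s a s'| ≤ R) (q : S × A → ℝ)
    (hq : ∀ x, |q x| ≤ R / (1 - M.γ)) (x : S × A) (s' : S) :
    |tdTarget M q x s'| ≤ R / (1 - M.γ) := by
  have h1 : 0 < 1 - M.γ := by linarith [M.γ_lt_one]
  have h2 : |M.γ * ⨆ a, q (s', a)| ≤ M.γ * (R / (1 - M.γ)) := by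
    rw [abs_mul, abs_of_nonneg M.γ_nonneg]
    exact mul_le_mul_of_nonneg_left (abs_iSup_le_of_abs_le _ _ fun a => hq _) M.γ_nonneg
  have h3 : R + M.γ * (R / (1 - M.γ)) = R / (1 - M.γ) := by field_simp; ring
  have h4 := abs_mean_le hN (fun i => M.r i x.1 x.2 s') R fun i => hr _ _ _ _
  exact (abs_add_le _ _).trans (by linarith)

theorem abs_bellman_le [Nonempty A] (M : MAMDP N S A) (hN : N ≠ 0) {R : ℝ}
    (hr : ∀ i s a s', |M.r i s a s'| ≤ R) (q : S × A → ℝ)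
    (hq : ∀ x, |q x| ≤ R / (1 - M.γ)) (x : S × A) :
    |bellman M q x| ≤ R / (1 - M.γ) := by
  calc |bellman M q x| ≤ ∑ s', |M.P x.1 x.2 s' * tdTarget M q x s'| :=
        Finset.abs_sum_le_sum_abs _ _
    _ ≤ ∑ s', M.P x.1 x.2 s' * (R / (1 - M.γ)) := Finset.sum_le_sum fun s' _ => by
        rw [abs_mul, abs_of_nonneg (M.P_nonneg _ _ _)]
        exact mul_le_mul_of_nonneg_left (abs_tdTarget_le M hN hr q hq x s') (M.P_nonneg _ _ _)
    _ = _ := by rw [← Finset.sum_mul, M.P_sum, one_mul]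

theorem abs_bellman_sub_le [Nonempty A] (M : MAMDP N S A) (q q' : S × A → ℝ) (x : S × A) :
    |bellman M q x - bellman M q' x| ≤ M.γ * ‖q - q'‖ := by
  have h := (bellman_contracting M).2.dist_le_mul q q'
  rw [← Real.dist_eq]
  refine (dist_le_pi_dist _ _ x).trans ?_
  rw [← dist_eq_norm]
  exact h

/-- Compare the fixed point with the image of the zero table, which is bounded by `R`, and use the
contraction. -/
theorem abs_optimalQ_le [Nonempty A] (M : MAMDP N S A) (hN : N ≠ 0) {R : ℝ} (hR : 0 ≤ R)
    (hr : ∀ i s a s', |M.r i s a s'| ≤ R) (x : S × A) : |optimalQ M x| ≤ R / (1 - M.γ) := by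
  have h1 : 0 < 1 - M.γ := by linarith [M.γ_lt_one]
  have h0 : ∀ x, |bellman M 0 x| ≤ R := by
    intro x
    calc |bellman M 0 x| ≤ ∑ s', |M.P x.1 x.2 s' * tdTarget M 0 x s'| :=
          Finset.abs_sum_le_sum_abs _ _
      _ ≤ ∑ s', M.P x.1 x.2 s' * R := Finset.sum_le_sum fun s' _ => by
          rw [abs_mul, abs_of_nonneg (M.P_nonneg _ _ _)]
          refine mul_le_mul_of_nonneg_left ?_ (M.P_nonneg _ _ _)
          simpa [tdTarget] using abs_mean_le hN (fun i => M.r i x.1 x.2 s') R fun i => hr _ _ _ _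
      _ = _ := by rw [← Finset.sum_mul, M.P_sum, one_mul]
  have h2 : ‖optimalQ M‖ ≤ R + M.γ * ‖optimalQ M‖ := by
    refine (pi_norm_le_iff_of_nonneg (by have := M.γ_nonneg; positivity)).2 fun x => ?_
    have h3 := abs_bellman_sub_le M (optimalQ M) 0 x
    rw [bellman_optimalQ, sub_zero] at h3
    have h4 := abs_add_le (optimalQ M x - bellman M 0 x) (bellman M 0 x)
    rw [sub_add_cancel] at h4
    rw [Real.norm_eq_abs]
    linarith [h0 x]
  have h5 : ‖optimalQ M‖ ≤ R / (1 - M.γ) := by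
    rw [le_div_iff₀ h1]; linarith
  exact (norm_le_pi_norm (optimalQ M) x).trans h5

theorem abs_consensusError_le [Nonempty A] (M : MAMDP N S A) (hN : N ≠ 0)
    (Q : Fin N → S × A → ℝ) (s' : S) (c : ℝ) (h : ∀ i x, |Q i x - avg Q x| ≤ c) :
    |consensusError M Q s'| ≤ c := by
  have h1 := abs_mean_le hN (fun i => (⨆ a, Q i (s', a)) - ⨆ a, avg Q (s', a)) c fun i =>
    abs_iSup_sub_iSup_le _ _ _ fun a => h i (s', a)
  rw [consensusError, abs_mul, abs_of_nonneg M.γ_nonneg]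
  exact (mul_le_of_le_one_left (abs_nonneg _) M.γ_lt_one.le).trans h1

variable [DecidableEq S] [DecidableEq A]

theorem abs_qStep_le [Nonempty A] (M : MAMDP N S A) {R : ℝ} (hr : ∀ i s a s', |M.r i s a s'| ≤ R)
    {W : Matrix (Fin N) (Fin N) ℝ} (hW : W ∈ doublyStochastic ℝ (Fin N)) {α : ℝ} (hα : 0 ≤ α)
    (hαW : ∀ i, α ≤ W i i) (Q : Fin N → S × A → ℝ) (hQ : ∀ i x, |Q i x| ≤ R / (1 - M.γ))
    (x : S × A) (s' : S) (i : Fin N) (y : S × A) : |qStep M W α Q x s' i y| ≤ R / (1 - M.γ) := by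
  have h0 := fun i j => nonneg_of_mem_doublyStochastic hW (i := i) (j := j)
  have hsum := sum_row_of_mem_doublyStochastic hW i
  have hbound : ∀ w : Fin N → ℝ, (∀ j, 0 ≤ w j) →
      |∑ j, w j * Q j y| ≤ (∑ j, w j) * (R / (1 - M.γ)) := by
    intro w hw
    rw [Finset.sum_mul]
    refine (Finset.abs_sum_le_sum_abs _ _).trans (Finset.sum_le_sum fun j _ => ?_)
    rw [abs_mul, abs_of_nonneg (hw j)]
    exact mul_le_mul_of_nonneg_left (hQ j y) (hw j)
  unfold qStep
  by_cases hy : y = x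
  · rw [if_pos hy]
    -- At the visited pair the new entry combines old entries with weights `W i j`, lowered by `α`
    -- at `j = i`, and the target with weight `α`. These weights are nonnegative and sum to one.
    have hw := hbound (fun j => W i j - if i = j then α else 0) fun j => by
      by_cases hij : i = j
      · subst hij; simpa using hαW i
      · simpa [hij] using h0 i j
    have e1 : ∑ j, (W i j - if i = j then α else 0) * Q j y = ∑ j, W i j * Q j y - α * Q i x := by
      simp [sub_mul, Finset.sum_sub_distrib, hy]
    have e2 : ∑ j, (W i j - if i = j then α else 0) = 1 - α := by
      simp [Finset.sum_sub_distrib, hsum]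
    rw [e1, e2] at hw
    have htd := abs_td_error_le M i (hr i) (Q i) (hQ i) x s'
    have htd' : |α * (M.r i x.1 x.2 s' + M.γ * ⨆ a, Q i (s', a))| ≤ α * (R / (1 - M.γ)) := by
      rw [abs_mul, abs_of_nonneg hα]
      exact mul_le_mul_of_nonneg_left htd hα
    have := abs_add_le (∑ j, W i j * Q j y - α * Q i x)
      (α * (M.r i x.1 x.2 s' + M.γ * ⨆ a, Q i (s', a)))
    calc _ = |(∑ j, W i j * Q j y - α * Q i x) +
          α * (M.r i x.1 x.2 s' + M.γ * ⨆ a, Q i (s', a))| := by congr 1; ring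
      _ ≤ _ := by linarith
  · rw [if_neg hy, add_zero]
    simpa [hsum] using hbound (W i) (h0 i)

theorem abs_qIter_le [Nonempty A] (M : MAMDP N S A) {R : ℝ} (hr : ∀ i s a s', |M.r i s a s'| ≤ R)
    {W : Matrix (Fin N) (Fin N) ℝ} (hW : W ∈ doublyStochastic ℝ (Fin N)) {α : ℝ} (hα : 0 ≤ α)
    (hαW : ∀ i, α ≤ W i i) (Q₀ : Fin N → S × A → ℝ) (hQ : ∀ i x, |Q₀ i x| ≤ R / (1 - M.γ))
    (x : ℕ → S × A) (k : ℕ) (i : Fin N) (y : S × A) :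
    |qIter M W α Q₀ x k i y| ≤ R / (1 - M.γ) := by
  induction k generalizing i y with
  | zero => exact hQ i y
  | succ k ih => exact abs_qStep_le M hr hW hα hαW _ ih _ _ _ _

/-- Centering commutes with a doubly stochastic `W`, so the mixing part contracts by `sigma2 W`. The
rest is `α` times a centered vector of temporal-difference errors, each at most `2 R / (1 - γ)`. -/
theorem norm_centered_qStep_le [Nonempty A] (M : MAMDP N S A) (hN : N ≠ 0) {R : ℝ}
    (hr : ∀ i s a s', |M.r i s a s'| ≤ R)
    {W : Matrix (Fin N) (Fin N) ℝ} (hW : W ∈ doublyStochastic ℝ (Fin N))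
    (hσ : ∀ v : EuclideanSpace ℝ (Fin N), ∑ i, v i = 0 →
      ‖Matrix.toEuclideanLin W v‖ ≤ sigma2 W * ‖v‖) {α : ℝ} (hα : 0 ≤ α)
    (Q : Fin N → S × A → ℝ) (hQ : ∀ i x, |Q i x| ≤ R / (1 - M.γ)) (x : S × A) (s' : S)
    (y : S × A) : ‖centered fun i => qStep M W α Q x s' i y‖ ≤
      sigma2 W * ‖centered fun i => Q i y‖ + α * (√N * (2 * (R / (1 - M.γ)))) := by
  let δ : Fin N → ℝ := fun i => M.r i x.1 x.2 s' + M.γ * (⨆ a, Q i (s', a)) - Q i x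
  have hδ : ∀ i, |δ i| ≤ 2 * (R / (1 - M.γ)) := fun i => by
    have h1 := abs_td_error_le M i (hr i) (Q i) (hQ i) x s'
    have h2 := hQ i x
    exact (abs_sub _ _).trans (by linarith)
  have heq : (centered fun i => qStep M W α Q x s' i y) =
      Matrix.toEuclideanLin W (centered fun i => Q i y) +
        (if y = x then α else 0) • centered δ := by
    ext i
    have h1 : (1 / (N : ℝ)) * ∑ j, qStep M W α Q x s' j y = _ := avg_qStep M hW α Q x s' y
    have h2 : Matrix.toEuclideanLin W (centered fun i => Q i y) i =
        ∑ j, W i j * Q j y - avg Q y := by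
      simp only [centered, Matrix.toLpLin_apply, Matrix.mulVec, dotProduct, mul_sub,
        Finset.sum_sub_distrib]
      rw [← Finset.sum_mul, sum_row_of_mem_doublyStochastic hW, one_mul]
      rfl
    rw [PiLp.add_apply, h2, PiLp.smul_apply]
    simp only [centered, h1, smul_eq_mul]
    unfold qStep
    by_cases hy : y = x
    · simp only [hy, if_true, δ]
      ring
    · simp [hy]
  rw [heq]
  refine (norm_add_le _ _).trans (add_le_add (hσ _ (sum_centered hN _)) ?_)
  rw [norm_smul]
  refine mul_le_mul ?_ (norm_centered_le hN _ _ hδ) (norm_nonneg _) hα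
  split_ifs
  · rw [Real.norm_eq_abs, abs_of_nonneg hα]
  · simpa using hα

theorem le_geom_of_le_mul_add {a b c σ : ℝ} (hσ0 : 0 ≤ σ) (hσ1 : σ < 1) (hb : 0 ≤ b) (f : ℕ → ℝ)
    (h0 : f 0 ≤ a) (h : ∀ k, f (k + 1) ≤ σ * f k + c * b) (hc : 0 ≤ c) (k : ℕ) :
    f k ≤ σ ^ k * a + c * b / (1 - σ) := by
  have h1 : 0 < 1 - σ := by linarith
  induction k with
  | zero => simpa using h0.trans (le_add_of_nonneg_right (by positivity))
  | succ k ih =>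
    calc f (k + 1) ≤ σ * f k + c * b := h k
      _ ≤ σ * (σ ^ k * a + c * b / (1 - σ)) + c * b := by gcongr
      _ = _ := by field_simp; ring

theorem abs_qIter_sub_avg_le [Nonempty A] (M : MAMDP N S A) (hN : N ≠ 0) {R : ℝ}
    (hr : ∀ i s a s', |M.r i s a s'| ≤ R)
    {W : Matrix (Fin N) (Fin N) ℝ} (hW : W ∈ doublyStochastic ℝ (Fin N)) (hσ1 : sigma2 W < 1)
    (hσ : ∀ v : EuclideanSpace ℝ (Fin N), ∑ i, v i = 0 →
      ‖Matrix.toEuclideanLin W v‖ ≤ sigma2 W * ‖v‖) {α : ℝ} (hα : 0 ≤ α)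
    (hαW : ∀ i, α ≤ W i i) (Q₀ : Fin N → S × A → ℝ) (hQ : ∀ i x, |Q₀ i x| ≤ R / (1 - M.γ))
    (x : ℕ → S × A) (k : ℕ) (i : Fin N) (y : S × A) :
    |qIter M W α Q₀ x k i y - avg (qIter M W α Q₀ x k) y| ≤
      sigma2 W ^ k * (√N * (R / (1 - M.γ))) +
        α * (√N * (2 * (R / (1 - M.γ)))) / (1 - sigma2 W) := by
  have hR : 0 ≤ R / (1 - M.γ) := (abs_nonneg _).trans (hQ i y)
  have h1 := le_geom_of_le_mul_add (sigma2_nonneg W) hσ1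
    (b := √N * (2 * (R / (1 - M.γ)))) (by positivity)
    (fun k => ‖centered fun i => qIter M W α Q₀ x k i y‖)
    (norm_centered_le hN _ _ fun i => hQ i y)
    (fun k => norm_centered_qStep_le M hN hr hW hσ hα _
      (abs_qIter_le M hr hW hα hαW Q₀ hQ x k) _ _ _) hα k
  exact (PiLp.norm_apply_le (centered fun i => qIter M W α Q₀ x k i y) i).trans h1

theorem abs_avg_qStep_sub_le [Nonempty A] (M : MAMDP N S A) (hN : N ≠ 0) {R : ℝ}
    (hr : ∀ i s a s', |M.r i s a s'| ≤ R)
    {W : Matrix (Fin N) (Fin N) ℝ} (hW : W ∈ doublyStochastic ℝ (Fin N)) {α : ℝ} (hα : 0 ≤ α)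
    (Q : Fin N → S × A → ℝ) (hQ : ∀ i x, |Q i x| ≤ R / (1 - M.γ)) (x : S × A) (s' : S)
    (y : S × A) :
    |avg (qStep M W α Q x s') y - avg Q y| ≤ α * (2 * (R / (1 - M.γ))) := by
  have hR : 0 ≤ R / (1 - M.γ) := (abs_nonneg _).trans (hQ ⟨0, Nat.pos_of_ne_zero hN⟩ y)
  rw [avg_qStep M hW, add_sub_cancel_left]
  split_ifs
  · rw [abs_mul, abs_of_nonneg hα]
    refine mul_le_mul_of_nonneg_left (abs_mean_le hN _ _ fun i => ?_) hα
    have h1 := abs_td_error_le M i (hr i) (Q i) (hQ i) x s'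
    have h2 := hQ i x
    exact (abs_sub _ _).trans (by linarith)
  · rw [abs_zero]; positivity

end Path

/-! ### The truncated Poisson equation of the chain. -/

section Poisson

variable {X : Type*} [Fintype X] [DecidableEq X]

/-- Truncated solution of the Poisson equation for the centered indicator of `x`. -/
noncomputable def poisson (K : Matrix X X ℝ) (d : X → ℝ) (τ : ℕ) (x y : X) : ℝ :=
  ∑ t ∈ Finset.range τ, ((K ^ t) y x - d x)

/-- Conditional expectation of `poisson` after one step of the chain. -/
noncomputable def poissonNext (K : Matrix X X ℝ) (d : X → ℝ) (τ : ℕ) (x y : X) : ℝ :=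
  ∑ z, K y z * poisson K d τ x z

variable {K : Matrix X X ℝ} {d : X → ℝ}

theorem poissonNext_eq (hK : K ∈ Matrix.rowStochastic ℝ X) (τ : ℕ) (x y : X) :
    poissonNext K d τ x y = ∑ t ∈ Finset.range τ, ((K ^ (t + 1)) y x - d x) := by
  unfold poissonNext poisson
  simp_rw [Finset.mul_sum]
  rw [Finset.sum_comm]
  refine Finset.sum_congr rfl fun t _ => ?_
  simp_rw [mul_sub]
  rw [Finset.sum_sub_distrib, ← Finset.sum_mul, Matrix.sum_row_of_mem_rowStochastic hK, one_mul,
    pow_succ', Matrix.mul_apply]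

/-- One step of the chain shifts the sum by one index, so only the terms `t = 0` and `t = τ`
survive. After mixing, the right side is the centered indicator up to `2α`. -/
theorem poisson_sub_poissonNext (hK : K ∈ Matrix.rowStochastic ℝ X) (τ : ℕ) (x y : X) :
    poisson K d τ x y - poissonNext K d τ x y = (if x = y then 1 else 0) - (K ^ τ) y x := by
  rw [poissonNext_eq hK, poisson, ← Finset.sum_sub_distrib]
  have h := Finset.sum_range_sub' (fun t => (K ^ t) y x) τ
  simp only [sub_sub_sub_cancel_right]
  rw [h, pow_zero, Matrix.one_apply]
  simp [eq_comm]

theorem abs_pow_sub_le (hK : K ∈ Matrix.rowStochastic ℝ X) (hd0 : ∀ x, 0 ≤ d x)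
    (hd1 : ∀ x, d x ≤ 1) (t : ℕ) (x y : X) : |(K ^ t) y x - d x| ≤ 1 := by
  have h := pow_mem hK t
  have h1 := Matrix.le_one_of_mem_rowStochastic h (i := y) (j := x)
  have h2 := Matrix.nonneg_of_mem_rowStochastic h (i := y) (j := x)
  rw [abs_le]
  constructor <;> linarith [hd0 x, hd1 x]

theorem abs_poisson_le (hK : K ∈ Matrix.rowStochastic ℝ X) (hd0 : ∀ x, 0 ≤ d x)
    (hd1 : ∀ x, d x ≤ 1) (τ : ℕ) (x y : X) : |poisson K d τ x y| ≤ τ := by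
  refine (Finset.abs_sum_le_sum_abs _ _).trans ?_
  simpa using Finset.sum_le_sum fun t (_ : t ∈ Finset.range τ) => abs_pow_sub_le hK hd0 hd1 t x y

theorem abs_poissonNext_le (hK : K ∈ Matrix.rowStochastic ℝ X) (hd0 : ∀ x, 0 ≤ d x)
    (hd1 : ∀ x, d x ≤ 1) (τ : ℕ) (x y : X) : |poissonNext K d τ x y| ≤ τ := by
  rw [poissonNext_eq hK]
  refine (Finset.abs_sum_le_sum_abs _ _).trans ?_
  simpa using Finset.sum_le_sum fun t (_ : t ∈ Finset.range τ) =>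
    abs_pow_sub_le hK hd0 hd1 (t + 1) x y

/-- Each power's row and `d` have total mass one, so summing over `x` costs no factor of the
cardinality of `X`. -/
theorem sum_abs_poisson_le (hK : K ∈ Matrix.rowStochastic ℝ X) (hd0 : ∀ x, 0 ≤ d x)
    (hds : ∑ x, d x = 1) (τ : ℕ) (y : X) : ∑ x, |poisson K d τ x y| ≤ 2 * τ := by
  calc ∑ x, |poisson K d τ x y| ≤ ∑ x, ∑ t ∈ Finset.range τ, ((K ^ t) y x + d x) := by
        refine Finset.sum_le_sum fun x _ => (Finset.abs_sum_le_sum_abs _ _).trans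
          (Finset.sum_le_sum fun t _ => (abs_sub _ _).trans ?_)
        rw [abs_of_nonneg (hd0 x),
          abs_of_nonneg (Matrix.nonneg_of_mem_rowStochastic (pow_mem hK t))]
    _ = ∑ t ∈ Finset.range τ, (2 : ℝ) := by
        rw [Finset.sum_comm]
        refine Finset.sum_congr rfl fun t _ => ?_
        rw [Finset.sum_add_distrib, Matrix.sum_row_of_mem_rowStochastic (pow_mem hK t), hds]
        norm_num
    _ = 2 * τ := by simp [mul_comm]

theorem sum_poisson_sq_le (hK : K ∈ Matrix.rowStochastic ℝ X) (hd0 : ∀ x, 0 ≤ d x)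
    (hd1 : ∀ x, d x ≤ 1) (hds : ∑ x, d x = 1) (τ : ℕ) (y : X) :
    ∑ x, poisson K d τ x y ^ 2 ≤ 2 * (τ : ℝ) ^ 2 := by
  calc ∑ x, poisson K d τ x y ^ 2 ≤ ∑ x, τ * |poisson K d τ x y| :=
        Finset.sum_le_sum fun x _ => by
          rw [← sq_abs, sq]
          exact mul_le_mul_of_nonneg_right (abs_poisson_le hK hd0 hd1 τ x y) (abs_nonneg _)
    _ = τ * ∑ x, |poisson K d τ x y| := by rw [Finset.mul_sum]
    _ ≤ τ * (2 * τ) :=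
        mul_le_mul_of_nonneg_left (sum_abs_poisson_le hK hd0 hds τ y) (Nat.cast_nonneg _)
    _ = _ := by ring

/-- Factor the difference of squares: the difference has total mass at most `2` by the Poisson
equation, and the sum is at most `2 τ` pointwise. This is where `τ` appears instead of `τ ^ 2`. -/
theorem sum_poisson_sq_sub_le (hK : K ∈ Matrix.rowStochastic ℝ X) (hd0 : ∀ x, 0 ≤ d x)
    (hd1 : ∀ x, d x ≤ 1) (τ : ℕ) (y : X) :
    ∑ x, (poisson K d τ x y ^ 2 - poissonNext K d τ x y ^ 2) ≤ 4 * τ := by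
  have hp := pow_mem hK τ
  calc ∑ x, (poisson K d τ x y ^ 2 - poissonNext K d τ x y ^ 2)
      ≤ ∑ x, ((if x = y then 1 else 0) + (K ^ τ) y x) * (2 * (τ : ℝ)) := by
        refine Finset.sum_le_sum fun x _ => ?_
        rw [sq_sub_sq, mul_comm, poisson_sub_poissonNext hK]
        refine (le_abs_self _).trans ?_
        rw [abs_mul]
        refine mul_le_mul ?_ ?_ (abs_nonneg _) ?_
        · refine (abs_sub _ _).trans (le_of_eq ?_)
          rw [abs_of_nonneg (Matrix.nonneg_of_mem_rowStochastic hp), abs_of_nonneg]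
          split_ifs <;> norm_num
        · refine (abs_add_le _ _).trans ?_
          linarith [abs_poisson_le hK hd0 hd1 τ x y, abs_poissonNext_le hK hd0 hd1 τ x y]
        · refine add_nonneg ?_ (Matrix.nonneg_of_mem_rowStochastic hp)
          split_ifs <;> norm_num
    _ = 4 * τ := by
        rw [← Finset.sum_mul, Finset.sum_add_distrib, Matrix.sum_row_of_mem_rowStochastic hp]
        simp
        ring

theorem abs_pow_sub_le_of_mixedAt {α : ℝ} {τ : ℕ} (h : MixedAt K d α τ) (x y : X) :
    |(K ^ τ) y x - d x| ≤ 2 * α := by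
  have h1 : (1 / 2) * ∑ x, |(K ^ τ) y x - d x| ≤ α := h y
  have h2 : |(K ^ τ) y x - d x| ≤ ∑ x, |(K ^ τ) y x - d x| :=
    Finset.single_le_sum (f := fun x => |(K ^ τ) y x - d x|)
      (fun x _ => abs_nonneg _) (Finset.mem_univ x)
  linarith

end Poisson

theorem saMatrix_mem_rowStochastic {N : ℕ} {S A : Type*} [Fintype S] [Fintype A] [DecidableEq S]
    [DecidableEq A] (M : MAMDP N S A) {β : S → A → ℝ} (hβ : IsPolicy β) :
    saMatrix M β ∈ Matrix.rowStochastic ℝ (S × A) := by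
  rw [Matrix.mem_rowStochastic_iff_sum]
  refine ⟨fun x y => mul_nonneg (M.P_nonneg _ _ _) (hβ.nonneg _ _), fun x => ?_⟩
  simp [saMatrix, Fintype.sum_prod_type, ← Finset.mul_sum, hβ.sum_eq_one, M.P_sum]

theorem sum_saMatrix_mul {N : ℕ} {S A : Type*} [Fintype S] [Fintype A] (M : MAMDP N S A)
    {β : S → A → ℝ} (hβ : IsPolicy β) (x : S × A) (f : S → ℝ) :
    ∑ y, saMatrix M β x y * f y.1 = ∑ s', M.P x.1 x.2 s' * f s' := by
  simp only [saMatrix, Fintype.sum_prod_type]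
  refine Finset.sum_congr rfl fun s' _ => ?_
  rw [← Finset.sum_mul, ← Finset.mul_sum, hβ.sum_eq_one, mul_one]

/-! ### Decomposition of the averaged error into noise, boundary term and contracting part. -/

section Noise

variable {N : ℕ} {S A : Type*} [Fintype S] [Fintype A] [DecidableEq S] [DecidableEq A]

/-- The martingale difference driving the averaged iterates, after the Markovian noise has been
decomposed by the Poisson equation. -/
noncomputable def noise (M : MAMDP N S A) (K : Matrix (S × A) (S × A) ℝ) (d : S × A → ℝ) (τ : ℕ)
    (q : S × A → ℝ) (x x' y : S × A) : ℝ :=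
  (if y = x then tdTarget M q x x'.1 - bellman M q x else 0) +
    (bellman M q y - q y) * (poisson K d τ y x' - poissonNext K d τ y x)

/-- The noise accumulated along a path, discounted at the rate `α * d y` in coordinate `y`. -/
noncomputable def noiseSum (M : MAMDP N S A) (W : Matrix (Fin N) (Fin N) ℝ) (α : ℝ)
    (K : Matrix (S × A) (S × A) ℝ) (d : S × A → ℝ) (τ : ℕ) (Q₀ : Fin N → S × A → ℝ)
    (x : ℕ → S × A) : ℕ → S × A → ℝ
  | 0 => 0
  | k + 1 => fun y => (1 - α * d y) * noiseSum M W α K d τ Q₀ x k y +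
      α * noise M K d τ (avg (qIter M W α Q₀ x k)) (x k) (x (k + 1)) y

/-- The averaged error with the accumulated noise and the Poisson boundary term removed. -/
noncomputable def corrected (M : MAMDP N S A) [Nonempty A] (W : Matrix (Fin N) (Fin N) ℝ) (α : ℝ)
    (K : Matrix (S × A) (S × A) ℝ) (d : S × A → ℝ) (τ : ℕ) (Q₀ : Fin N → S × A → ℝ)
    (x : ℕ → S × A) (k : ℕ) : S × A → ℝ := fun y =>
  avg (qIter M W α Q₀ x k) y - optimalQ M y - noiseSum M W α K d τ Q₀ x k y +
    α * (bellman M (avg (qIter M W α Q₀ x k)) y - avg (qIter M W α Q₀ x k) y) *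
      poisson K d τ y (x k)

variable [Nonempty A]

theorem norm_error_le (M : MAMDP N S A) (hN : N ≠ 0) {R : ℝ}
    (hr : ∀ i s a s', |M.r i s a s'| ≤ R)
    {W : Matrix (Fin N) (Fin N) ℝ} {α : ℝ} (hα : 0 ≤ α)
    {K : Matrix (S × A) (S × A) ℝ} (hK : K ∈ Matrix.rowStochastic ℝ (S × A)) {d : S × A → ℝ}
    (hd0 : ∀ x, 0 ≤ d x) (hd1 : ∀ x, d x ≤ 1) (τ : ℕ) (Q₀ : Fin N → S × A → ℝ) (x : ℕ → S × A)
    (k : ℕ) (hQ : ∀ y, |avg (qIter M W α Q₀ x k) y| ≤ R / (1 - M.γ)) :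
    ‖avg (qIter M W α Q₀ x k) - optimalQ M‖ ≤ ‖corrected M W α K d τ Q₀ x k‖ +
      ‖noiseSum M W α K d τ Q₀ x k‖ + 2 * (α * τ * (R / (1 - M.γ))) := by
  have hR : 0 ≤ R / (1 - M.γ) := (abs_nonneg _).trans (hQ (x 0))
  refine (pi_norm_le_iff_of_nonneg (by positivity)).2 fun y => ?_
  have h1 := norm_le_pi_norm (corrected M W α K d τ Q₀ x k) y
  have h2 := norm_le_pi_norm (noiseSum M W α K d τ Q₀ x k) y
  have h3 : |α * (bellman M (avg (qIter M W α Q₀ x k)) y - avg (qIter M W α Q₀ x k) y) *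
      poisson K d τ y (x k)| ≤ α * (2 * (R / (1 - M.γ))) * τ := by
    rw [abs_mul, abs_mul, abs_of_nonneg hα]
    refine mul_le_mul (mul_le_mul_of_nonneg_left ?_ hα) (abs_poisson_le hK hd0 hd1 τ y _)
      (abs_nonneg _) (by positivity)
    exact (abs_sub _ _).trans (by linarith [abs_bellman_le M hN hr _ hQ y, hQ y])
  rw [Real.norm_eq_abs] at *
  have h4 : (avg (qIter M W α Q₀ x k) - optimalQ M) y = corrected M W α K d τ Q₀ x k y +
      noiseSum M W α K d τ Q₀ x k y -
      α * (bellman M (avg (qIter M W α Q₀ x k)) y - avg (qIter M W α Q₀ x k) y) *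
      poisson K d τ y (x k) := by
    rw [corrected, Pi.sub_apply]; ring
  rw [h4]
  refine (abs_sub _ _).trans ?_
  have := abs_add_le (corrected M W α K d τ Q₀ x k y) (noiseSum M W α K d τ Q₀ x k y)
  linarith

/-- Let `g` be the Bellman residual of the averaged table. Replacing the centered indicator times
`g` through the Poisson equation leaves a difference of `g * poisson` at successive states. The
boundary term in `corrected` telescopes it, so only the change of `g`, itself of order `α`, and the
discount mismatch `α * d y` remain. -/
theorem corrected_succ (M : MAMDP N S A) (hN : N ≠ 0)
    {W : Matrix (Fin N) (Fin N) ℝ} (hW : W ∈ doublyStochastic ℝ (Fin N)) (α : ℝ)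
    {K : Matrix (S × A) (S × A) ℝ} (hK : K ∈ Matrix.rowStochastic ℝ (S × A)) (d : S × A → ℝ)
    (τ : ℕ) (Q₀ : Fin N → S × A → ℝ) (x : ℕ → S × A) (k : ℕ) (y : S × A) (Q : Fin N → S × A → ℝ)
    (hQ : Q = qIter M W α Q₀ x k) (Q' : Fin N → S × A → ℝ) (hQ' : Q' = qIter M W α Q₀ x (k + 1)) :
    corrected M W α K d τ Q₀ x (k + 1) y =
      (1 - α * d y) * corrected M W α K d τ Q₀ x k y +
      α * d y * (bellman M (avg Q) y - bellman M (optimalQ M) y) +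
      α * d y * (α * (bellman M (avg Q) y - avg Q y) * poisson K d τ y (x k)) +
      α * ((bellman M (avg Q') y - bellman M (avg Q) y) - (avg Q' y - avg Q y)) *
        poisson K d τ y (x (k + 1)) +
      α * (bellman M (avg Q) y - avg Q y) * ((K ^ τ) (x k) y - d y) +
      α * (if y = x k then consensusError M Q (x (k + 1)).1 else 0) := by
  have hE : avg Q' y = avg Q y + if y = x k then
      α * (tdTarget M (avg Q) (x k) (x (k + 1)).1 - avg Q (x k) +
        consensusError M Q (x (k + 1)).1) else 0 := by
    rw [hQ', hQ]
    exact avg_qStep_eq M hN hW α _ _ _ y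
  have hp := poisson_sub_poissonNext (d := d) hK τ y (x k)
  have hopt : bellman M (optimalQ M) y = optimalQ M y := by rw [bellman_optimalQ]
  simp only [corrected, noiseSum, noise, ← hQ, ← hQ']
  by_cases hy : y = x k
  · simp only [hy, if_true] at *
    linear_combination hE - α * (bellman M (avg Q) (x k) - avg Q (x k)) * hp + α * d (x k) * hopt
  · simp only [hy, if_false] at *
    linear_combination hE - α * (bellman M (avg Q) y - avg Q y) * hp + α * d y * hopt

/-- The Bellman term acts on the full error, which `norm_error_le` compares with `corrected` and
`noiseSum`. The resulting factor is `1 - α d y + α d y γ`, at most `1 - α (1 - γ) dmin`. -/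
theorem norm_corrected_succ_le (M : MAMDP N S A) (hN : N ≠ 0) {R : ℝ}
    (hr : ∀ i s a s', |M.r i s a s'| ≤ R)
    {W : Matrix (Fin N) (Fin N) ℝ} (hW : W ∈ doublyStochastic ℝ (Fin N)) {α : ℝ} (hα : 0 ≤ α)
    (hα1 : α ≤ 1) (hαW : ∀ i, α ≤ W i i)
    {K : Matrix (S × A) (S × A) ℝ} (hK : K ∈ Matrix.rowStochastic ℝ (S × A)) {d : S × A → ℝ}
    (hd0 : ∀ x, 0 ≤ d x) (hd1 : ∀ x, d x ≤ 1) {dmin dmax : ℝ} (hdmin : ∀ x, dmin ≤ d x)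
    (hdmax : ∀ x, d x ≤ dmax)
    {τ : ℕ} (hτ : 1 ≤ τ) (hmix : MixedAt K d α τ) (Q₀ : Fin N → S × A → ℝ)
    (hQ₀ : ∀ i x, |Q₀ i x| ≤ R / (1 - M.γ)) (x : ℕ → S × A) (k : ℕ) (c : ℝ)
    (hc : ∀ i y, |qIter M W α Q₀ x k i y - avg (qIter M W α Q₀ x k) y| ≤ c) :
    ‖corrected M W α K d τ Q₀ x (k + 1)‖ ≤
      (1 - α * (1 - M.γ) * dmin) * ‖corrected M W α K d τ Q₀ x k‖ +
      α * (dmax * ‖noiseSum M W α K d τ Q₀ x k‖ + 12 * (α * τ * (R / (1 - M.γ))) + c) := by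
  set R' := R / (1 - M.γ) with hR'
  set Q := qIter M W α Q₀ x k with hQdef
  set Q' := qIter M W α Q₀ x (k + 1) with hQdef'
  have hQi := abs_qIter_le M hr hW hα hαW Q₀ hQ₀ x k
  have hq : ∀ y, |avg Q y| ≤ R' := fun y => abs_avg_le hN _ _ _ fun i => hQi i y
  have hR : 0 ≤ R' := (abs_nonneg _).trans (hq (x 0))
  have hγ0 := M.γ_nonneg
  have hγ1 := M.γ_lt_one
  have hτ1 : (1 : ℝ) ≤ τ := by exact_mod_cast hτ
  have hc0 : 0 ≤ c := (abs_nonneg _).trans (hc ⟨0, Nat.pos_of_ne_zero hN⟩ (x 0))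
  have hE := norm_error_le M hN hr (W := W) hα hK hd0 hd1 τ Q₀ x k hq
  set v := ‖corrected M W α K d τ Q₀ x k‖ with hv
  set u := ‖noiseSum M W α K d τ Q₀ x k‖ with hu
  have hv0 : 0 ≤ v := norm_nonneg _
  have hu0 : 0 ≤ u := norm_nonneg _
  have hdiff : ∀ y, |avg Q' y - avg Q y| ≤ α * (2 * R') := fun y =>
    abs_avg_qStep_sub_le M hN hr hW hα Q hQi (x k) (x (k + 1)).1 y
  have hdiffn : ‖avg Q' - avg Q‖ ≤ α * (2 * R') :=
    (pi_norm_le_iff_of_nonneg (by positivity)).2 hdiff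
  -- The constant `12` is `2 + 2 + 4 + 4`, from `t2`, `t3`, `t4` and `t5`; the last uses `τ ≥ 1`.
  have hpt : ∀ y, |corrected M W α K d τ Q₀ x (k + 1) y| ≤
      (1 - α * (1 - M.γ) * dmin) * v + α * (dmax * u + 12 * (α * τ * R') + c) := by
    intro y
    have hαd : α * d y ≤ 1 := mul_le_one₀ hα1 (hd0 y) (hd1 y)
    have hαd0 : 0 ≤ α * d y := mul_nonneg hα (hd0 y)
    have hg : |bellman M (avg Q) y - avg Q y| ≤ 2 * R' :=
      (abs_sub _ _).trans (by linarith [abs_bellman_le M hN hr _ hq y, hq y])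
    rw [corrected_succ M hN hW α hK d τ Q₀ x k y Q hQdef Q' hQdef']
    have t1 : |(1 - α * d y) * corrected M W α K d τ Q₀ x k y| ≤ (1 - α * d y) * v := by
      rw [abs_mul, abs_of_nonneg (by linarith)]
      exact mul_le_mul_of_nonneg_left (norm_le_pi_norm (corrected M W α K d τ Q₀ x k) y)
        (by linarith)
    have t2 : |α * d y * (bellman M (avg Q) y - bellman M (optimalQ M) y)| ≤
        α * d y * (M.γ * v + u + 2 * (α * τ * R')) := by
      rw [abs_mul, abs_of_nonneg hαd0]
      refine mul_le_mul_of_nonneg_left ?_ hαd0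
      refine (abs_bellman_sub_le M _ _ y).trans ((mul_le_mul_of_nonneg_left hE hγ0).trans ?_)
      have h1 : 0 ≤ u + 2 * (α * τ * R') := by positivity
      nlinarith [mul_le_of_le_one_left h1 hγ1.le]
    have t3 : |α * d y * (α * (bellman M (avg Q) y - avg Q y) * poisson K d τ y (x k))| ≤
        α * (α * (2 * R') * τ) := by
      rw [abs_mul, abs_of_nonneg hαd0, abs_mul, abs_mul, abs_of_nonneg hα]
      exact mul_le_mul (mul_le_of_le_one_right hα (hd1 y))
        (mul_le_mul (mul_le_mul_of_nonneg_left hg hα) (abs_poisson_le hK hd0 hd1 τ y _)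
          (abs_nonneg _) (by positivity)) (by positivity) hα
    have t4 : |α * ((bellman M (avg Q') y - bellman M (avg Q) y) - (avg Q' y - avg Q y)) *
        poisson K d τ y (x (k + 1))| ≤ α * (4 * (α * R')) * τ := by
      rw [abs_mul, abs_mul, abs_of_nonneg hα]
      refine mul_le_mul (mul_le_mul_of_nonneg_left ?_ hα) (abs_poisson_le hK hd0 hd1 τ y _)
          (abs_nonneg _) (by positivity)
      have h1 := abs_bellman_sub_le M (avg Q') (avg Q) y
      have h2 : M.γ * ‖avg Q' - avg Q‖ ≤ α * (2 * R') :=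
        (mul_le_of_le_one_left (norm_nonneg _) hγ1.le).trans hdiffn
      exact (abs_sub _ _).trans (by linarith [hdiff y])
    have t5 : |α * (bellman M (avg Q) y - avg Q y) * ((K ^ τ) (x k) y - d y)| ≤
        α * (2 * R') * (2 * α) := by
      rw [abs_mul, abs_mul, abs_of_nonneg hα]
      exact mul_le_mul (mul_le_mul_of_nonneg_left hg hα) (abs_pow_sub_le_of_mixedAt hmix y (x k))
        (abs_nonneg _) (by positivity)
    have t6 : |α * (if y = x k then consensusError M Q (x (k + 1)).1 else 0)| ≤ α * c := by
      rw [abs_mul, abs_of_nonneg hα]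
      refine mul_le_mul_of_nonneg_left ?_ hα
      split_ifs
      · exact abs_consensusError_le M hN Q _ c hc
      · simpa using hc0
    refine (abs_add_le _ _).trans ?_
    refine (add_le_add_left ((abs_add_le _ _).trans (add_le_add_left ((abs_add_le _ _).trans
      (add_le_add_left ((abs_add_le _ _).trans (add_le_add_left (abs_add_le _ _) _)) _)) _)) _).trans
      ?_
    have s1 : α * (1 - M.γ) * dmin * v ≤ α * (1 - M.γ) * d y * v :=
      mul_le_mul_of_nonneg_right (mul_le_mul_of_nonneg_left (hdmin y)
        (mul_nonneg hα (by linarith))) hv0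
    have s2 : α * d y * u ≤ α * dmax * u :=
      mul_le_mul_of_nonneg_right (mul_le_mul_of_nonneg_left (hdmax y) hα) hu0
    have s3 : α * d y * (2 * (α * τ * R')) ≤ α * (2 * (α * τ * R')) :=
      mul_le_mul_of_nonneg_right (mul_le_of_le_one_right hα (hd1 y)) (by positivity)
    have s4 : α * (2 * R') * (2 * α) ≤ 4 * (α * (α * τ * R')) := by
      have : α * α * R' * 1 ≤ α * α * R' * τ := mul_le_mul_of_nonneg_left hτ1 (by positivity)
      linarith
    linarith
  refine (pi_norm_le_iff_of_nonneg ((abs_nonneg _).trans (hpt (x 0)))).2 hpt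

end Noise

/-! ### Calculus of bounded measurable functions. -/

/-- Bounded real functions measurable with respect to `m`. -/
structure BddMeas {Ω : Type*} (m : MeasurableSpace Ω) (f : Ω → ℝ) : Prop where
  meas : Measurable[m] f
  bdd : ∃ c, ∀ ω, |f ω| ≤ c

namespace BddMeas

variable {Ω : Type*} {m : MeasurableSpace Ω} {f g : Ω → ℝ}

theorem const (c : ℝ) : BddMeas m fun _ => c := ⟨measurable_const, |c|, fun _ => le_rfl⟩

theorem add (hf : BddMeas m f) (hg : BddMeas m g) : BddMeas m fun ω => f ω + g ω := by
  obtain ⟨a, ha⟩ := hf.bdd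
  obtain ⟨b, hb⟩ := hg.bdd
  exact ⟨hf.meas.add hg.meas, a + b, fun ω =>
    (abs_add_le _ _).trans (add_le_add (ha ω) (hb ω))⟩

theorem sub (hf : BddMeas m f) (hg : BddMeas m g) : BddMeas m fun ω => f ω - g ω := by
  obtain ⟨a, ha⟩ := hf.bdd
  obtain ⟨b, hb⟩ := hg.bdd
  exact ⟨hf.meas.sub hg.meas, a + b, fun ω =>
    (abs_sub _ _).trans (add_le_add (ha ω) (hb ω))⟩

theorem mul (hf : BddMeas m f) (hg : BddMeas m g) : BddMeas m fun ω => f ω * g ω := by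
  obtain ⟨a, ha⟩ := hf.bdd
  obtain ⟨b, hb⟩ := hg.bdd
  refine ⟨hf.meas.mul hg.meas, a * b, fun ω => ?_⟩
  rw [abs_mul]
  exact mul_le_mul (ha ω) (hb ω) (abs_nonneg _) ((abs_nonneg _).trans (ha ω))

theorem sq (hf : BddMeas m f) : BddMeas m fun ω => f ω ^ 2 := by
  simpa only [pow_two] using hf.mul hf

theorem sum {ι : Type*} (s : Finset ι) {F : ι → Ω → ℝ} (h : ∀ i, BddMeas m (F i)) :
    BddMeas m fun ω => ∑ i ∈ s, F i ω := by
  choose c hc using fun i => (h i).bdd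
  exact ⟨Finset.measurable_fun_sum _ fun i _ => (h i).meas, ∑ i ∈ s, c i, fun ω =>
    (Finset.abs_sum_le_sum_abs _ _).trans (Finset.sum_le_sum fun i _ => hc i ω)⟩

theorem iSup {ι : Type*} [Fintype ι] [Nonempty ι] {F : ι → Ω → ℝ} (h : ∀ i, BddMeas m (F i)) :
    BddMeas m fun ω => ⨆ i, F i ω := by
  choose c hc using fun i => (h i).bdd
  exact ⟨Measurable.iSup fun i => (h i).meas, ∑ i, |c i|, fun ω =>
    abs_iSup_le_of_abs_le _ _ fun i => (hc i ω).trans <| (le_abs_self _).trans <|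
      Finset.single_le_sum (f := fun i => |c i|) (fun i _ => abs_nonneg _) (Finset.mem_univ i)⟩

theorem ite (p : Prop) [Decidable p] (hf : BddMeas m f) (hg : BddMeas m g) :
    BddMeas m fun ω => if p then f ω else g ω := by
  split_ifs
  · exact hf
  · exact hg

theorem mono {m' : MeasurableSpace Ω} (hm : m ≤ m') (hf : BddMeas m f) : BddMeas m' f :=
  ⟨hf.meas.mono hm le_rfl, hf.bdd⟩

theorem indicator {s : Set Ω} (hs : MeasurableSet[m] s) (hf : BddMeas m f) :
    BddMeas m (s.indicator f) := by
  obtain ⟨a, ha⟩ := hf.bdd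
  refine ⟨hf.meas.indicator hs, a, fun ω => ?_⟩
  by_cases h : ω ∈ s
  · simpa [h] using ha ω
  · simpa [h] using (abs_nonneg _).trans (ha ω)

theorem select_eq_sum {X : Type*} [Fintype X] (F : X → Ω → ℝ) (Z : Ω → X) (ω : Ω) :
    F (Z ω) ω = ∑ x, {ω | Z ω = x}.indicator (F x) ω := by
  classical
  simp [Set.indicator_apply]

/-- Evaluation at a random index with finitely many values is a finite sum of indicators. -/
theorem select {X : Type*} [Fintype X] {F : X → Ω → ℝ} (hF : ∀ x, BddMeas m (F x)) {Z : Ω → X}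
    (hZ : ∀ x, MeasurableSet[m] {ω | Z ω = x}) : BddMeas m fun ω => F (Z ω) ω := by
  simp only [select_eq_sum F Z]
  exact sum _ fun x => (hF x).indicator (hZ x)

theorem norm {X : Type*} [Fintype X] {F : Ω → X → ℝ} (hF : ∀ x, BddMeas m fun ω => F ω x) :
    BddMeas m fun ω => ‖F ω‖ := by
  choose c hc using fun i => (hF i).bdd
  refine ⟨(measurable_pi_lambda _ fun x => (hF x).meas).norm, ∑ i, |c i|, fun ω => ?_⟩
  rw [abs_of_nonneg (norm_nonneg _)]
  exact (pi_norm_le_iff_of_nonneg (Finset.sum_nonneg fun _ _ => abs_nonneg _)).2 fun i =>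
    (hc i ω).trans <| (le_abs_self _).trans <|
      Finset.single_le_sum (f := fun i => |c i|) (fun i _ => abs_nonneg _) (Finset.mem_univ i)

theorem integrable {μ : Measure Ω} [IsFiniteMeasure μ] (hf : BddMeas m f) : Integrable f μ := by
  obtain ⟨a, ha⟩ := hf.bdd
  exact Integrable.of_bound hf.meas.aestronglyMeasurable a (ae_of_all _ ha)

end BddMeas

theorem sq_integral_le {Ω : Type*} {m : MeasurableSpace Ω} {μ : Measure Ω} [IsProbabilityMeasure μ]
    {f : Ω → ℝ} (hf : BddMeas m f) : (∫ ω, f ω ∂μ) ^ 2 ≤ ∫ ω, f ω ^ 2 ∂μ := by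
  set a := ∫ ω, f ω ∂μ with ha
  have h1 : 0 ≤ ∫ ω, (f ω - a) ^ 2 ∂μ := integral_nonneg fun ω => sq_nonneg _
  have h2 : ∫ ω, (f ω - a) ^ 2 ∂μ = ∫ ω, f ω ^ 2 ∂μ - a ^ 2 := by
    calc ∫ ω, (f ω - a) ^ 2 ∂μ = ∫ ω, (f ω ^ 2 - 2 * a * f ω + a ^ 2) ∂μ := by
          congr 1; ext ω; ring
      _ = _ := by
        have h := (BddMeas.const (2 * a)).mul hf
        rw [integral_add (hf.sq.sub h).integrable (integrable_const _),
          integral_sub hf.sq.integrable h.integrable, integral_const_mul, ← ha]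
        simp
        ring
  linarith

/-! ### Conditional expectations along the Markov chain. -/

section Markov

variable {X Ω : Type*} [Fintype X] {m : MeasurableSpace Ω} {μ : Measure Ω} [IsProbabilityMeasure μ]
  {ℱ : Filtration ℕ m} {K : Matrix X X ℝ} {Z : ℕ → Ω → X}

/-- Split according to the value of the next state, pull the `ℱ k`-measurable factor out of the
conditional expectation and apply the Markov property. -/
theorem IsMarkovChain.integral_next (hZ : IsMarkovChain μ ℱ K Z) (k : ℕ) {Φ : X → Ω → ℝ}
    (hΦ : ∀ y, BddMeas (ℱ k) (Φ y)) :
    ∫ ω, Φ (Z (k + 1) ω) ω ∂μ = ∫ ω, ∑ y, K (Z k ω) y * Φ y ω ∂μ := by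
  have hK : ∀ y, BddMeas (ℱ k) fun ω => K (Z k ω) y := fun y =>
    BddMeas.select (F := fun x _ => K x y) (fun x => BddMeas.const _) (hZ.adapted k)
  have hset : ∀ y, MeasurableSet[m] {ω | Z (k + 1) ω = y} := fun y =>
    ℱ.le (k + 1) _ (hZ.adapted (k + 1) y)
  have hind : ∀ y, BddMeas m ({ω | Z (k + 1) ω = y}.indicator fun _ => (1 : ℝ)) := fun y =>
    (BddMeas.const 1).indicator (hset y)
  have hΦm := fun y => (hΦ y).mono (ℱ.le k)
  simp only [BddMeas.select_eq_sum Φ (Z (k + 1))]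
  rw [integral_finsetSum _ fun y _ => ((hΦm y).indicator (hset y)).integrable,
    integral_finsetSum _ fun y _ => (((hK y).mono (ℱ.le k)).mul (hΦm y)).integrable]
  refine Finset.sum_congr rfl fun y _ => ?_
  have h1 : {ω | Z (k + 1) ω = y}.indicator (Φ y) =
      (Φ y) * {ω | Z (k + 1) ω = y}.indicator fun _ => (1 : ℝ) := by
    ext ω
    by_cases h : Z (k + 1) ω = y <;> simp [h]
  have h2 : μ[(Φ y) * {ω | Z (k + 1) ω = y}.indicator fun _ => (1 : ℝ) | ℱ k] =ᵐ[μ]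
      Φ y * μ[{ω | Z (k + 1) ω = y}.indicator fun _ => (1 : ℝ) | ℱ k] :=
    condExp_mul_of_stronglyMeasurable_left (hΦ y).meas.stronglyMeasurable
      (((hΦm y).mul (hind y)).integrable) (hind y).integrable
  rw [h1, ← integral_condExp (ℱ.le k)]
  refine integral_congr_ae ?_
  filter_upwards [h2, hZ.markov k y] with ω h3 h4
  rw [h3, Pi.mul_apply, h4, mul_comm]

variable [DecidableEq X] {d : X → ℝ}

/-- The increment is centered given the past, so its second moment is that of `poisson` at the new
state minus that of `poissonNext` at the old one. Trading `poissonNext` for `poisson` costs `4 τ`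
and leaves a telescoping difference. -/
theorem integral_sum_sq_poisson_sub_le (hZ : IsMarkovChain μ ℱ K Z)
    (hK : K ∈ Matrix.rowStochastic ℝ X) (hd0 : ∀ x, 0 ≤ d x) (hd1 : ∀ x, d x ≤ 1) (τ k : ℕ) :
    ∫ ω, ∑ y, (poisson K d τ y (Z (k + 1) ω) - poissonNext K d τ y (Z k ω)) ^ 2 ∂μ ≤
      ∫ ω, ∑ y, poisson K d τ y (Z (k + 1) ω) ^ 2 ∂μ -
        ∫ ω, ∑ y, poisson K d τ y (Z k ω) ^ 2 ∂μ + 4 * τ := by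
  have hsel : ∀ (j : ℕ) (f : X → ℝ), BddMeas (ℱ j) fun ω => f (Z j ω) := fun j f =>
    BddMeas.select (F := fun x _ => f x) (fun x => BddMeas.const _) (hZ.adapted j)
  have hselm : ∀ (j : ℕ) (f : X → ℝ), BddMeas m fun ω => f (Z j ω) := fun j f =>
    (hsel j f).mono (ℱ.le j)
  have hcross : ∀ y, ∫ ω, poisson K d τ y (Z (k + 1) ω) * poissonNext K d τ y (Z k ω) ∂μ =
      ∫ ω, poissonNext K d τ y (Z k ω) ^ 2 ∂μ := by
    intro y
    rw [hZ.integral_next k (Φ := fun x ω => poisson K d τ y x * poissonNext K d τ y (Z k ω))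
      fun x => (BddMeas.const _).mul (hsel k _)]
    congr 1
    ext ω
    simp only [← mul_assoc]
    rw [← Finset.sum_mul, sq]
    rfl
  have hp : ∀ (j : ℕ) y, BddMeas m fun ω => poisson K d τ y (Z j ω) := fun j y => hselm j _
  have hn : ∀ y, BddMeas m fun ω => poissonNext K d τ y (Z k ω) := fun y => hselm k _
  have h1 : ∫ ω, ∑ y, (poisson K d τ y (Z (k + 1) ω) - poissonNext K d τ y (Z k ω)) ^ 2 ∂μ =
      ∫ ω, ∑ y, poisson K d τ y (Z (k + 1) ω) ^ 2 ∂μ -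
        ∫ ω, ∑ y, poissonNext K d τ y (Z k ω) ^ 2 ∂μ := by
    rw [integral_finsetSum _ fun y _ => ((hp (k + 1) y).sub (hn y)).sq.integrable,
      integral_finsetSum _ fun y _ => (hp (k + 1) y).sq.integrable,
      integral_finsetSum _ fun y _ => (hn y).sq.integrable, ← Finset.sum_sub_distrib]
    refine Finset.sum_congr rfl fun y _ => ?_
    calc ∫ ω, (poisson K d τ y (Z (k + 1) ω) - poissonNext K d τ y (Z k ω)) ^ 2 ∂μ
        = ∫ ω, (poisson K d τ y (Z (k + 1) ω) ^ 2 -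
            2 * (poisson K d τ y (Z (k + 1) ω) * poissonNext K d τ y (Z k ω)) +
            poissonNext K d τ y (Z k ω) ^ 2) ∂μ := by congr 1; ext ω; ring
      _ = _ := by
        have h := (BddMeas.const 2).mul ((hp (k + 1) y).mul (hn y))
        rw [integral_add ((hp (k + 1) y).sq.sub h).integrable (hn y).sq.integrable,
          integral_sub (hp (k + 1) y).sq.integrable h.integrable, integral_const_mul, hcross]
        ring
  have h2 : ∫ ω, ∑ y, poisson K d τ y (Z k ω) ^ 2 ∂μ -
      ∫ ω, ∑ y, poissonNext K d τ y (Z k ω) ^ 2 ∂μ ≤ 4 * τ := by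
    have hi1 := (BddMeas.sum Finset.univ fun y => (hp k y).sq).integrable (μ := μ)
    have hi2 := (BddMeas.sum Finset.univ fun y => (hn y).sq).integrable (μ := μ)
    rw [← integral_sub hi1 hi2]
    refine (integral_mono (g := fun _ => 4 * (τ : ℝ)) (hi1.sub hi2) (integrable_const _)
      fun ω => ?_).trans (by simp)
    have := sum_poisson_sq_sub_le (d := d) hK hd0 hd1 τ (Z k ω)
    rwa [Finset.sum_sub_distrib] at this
  linarith

end Markov

/-! ### Measurability and boundedness of the iterates and the noise. -/

section Observable

variable {N : ℕ} {S A Ω : Type*}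

theorem BddMeas.avg {m : MeasurableSpace Ω} {Q : Ω → Fin N → S × A → ℝ} {y : S × A}
    (h : ∀ i, BddMeas m fun ω => Q ω i y) : BddMeas m fun ω => avg (Q ω) y :=
  (BddMeas.const _).mul (BddMeas.sum _ h)

variable [Fintype S] [Fintype A] [Nonempty A]

theorem BddMeas.tdTarget {m : MeasurableSpace Ω} (M : MAMDP N S A) {q : Ω → S × A → ℝ}
    (h : ∀ y, BddMeas m fun ω => q ω y) (x : S × A) (s' : S) :
    BddMeas m fun ω => tdTarget M (q ω) x s' :=
  (BddMeas.const _).add ((BddMeas.const _).mul (BddMeas.iSup fun _ => h _))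

theorem BddMeas.bellman {m : MeasurableSpace Ω} (M : MAMDP N S A) {q : Ω → S × A → ℝ}
    (h : ∀ y, BddMeas m fun ω => q ω y) (x : S × A) : BddMeas m fun ω => bellman M (q ω) x :=
  BddMeas.sum _ fun s' => (BddMeas.const _).mul (BddMeas.tdTarget M h x s')

end Observable

section Iterates

variable {N : ℕ} {S A Ω : Type*} [Fintype S] [Fintype A] [DecidableEq S] [DecidableEq A]
  [Nonempty A] {m : MeasurableSpace Ω} {μ : Measure Ω}
  {ℱ : Filtration ℕ m} {K : Matrix (S × A) (S × A) ℝ} {Z : ℕ → Ω → S × A}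

theorem BddMeas.qIter (hZ : IsMarkovChain μ ℱ K Z) (M : MAMDP N S A)
    (W : Matrix (Fin N) (Fin N) ℝ) (α : ℝ) {Q₀ : Ω → Fin N → S × A → ℝ}
    (hQ₀ : ∀ i x, BddMeas (ℱ 0) fun ω => Q₀ ω i x) (k : ℕ) (i : Fin N) (y : S × A) :
    BddMeas (ℱ k) fun ω => qIter M W α (Q₀ ω) (fun t => Z t ω) k i y := by
  induction k generalizing i y with
  | zero => exact hQ₀ i y
  | succ k ih =>
    have hle : ℱ k ≤ ℱ (k + 1) := ℱ.mono k.le_succ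
    have h := fun i y => (ih i y).mono hle
    have h1 : ∀ x x', BddMeas (ℱ (k + 1)) fun ω =>
        qStep M W α (DistQ.qIter M W α (Q₀ ω) (fun t => Z t ω) k) x x' i y := fun x x' =>
      (BddMeas.sum _ fun j => (BddMeas.const _).mul (h j y)).add
        (BddMeas.ite _ ((BddMeas.const _).mul
          (((BddMeas.const _).add ((BddMeas.const _).mul (BddMeas.iSup fun a => h i _))).sub
            (h i x))) (BddMeas.const 0))
    have h2 : ∀ x', BddMeas (ℱ (k + 1)) fun ω =>
        qStep M W α (DistQ.qIter M W α (Q₀ ω) (fun t => Z t ω) k) (Z k ω) x' i y := fun x' =>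
      BddMeas.select (fun x => h1 x x') fun x => hle _ (hZ.adapted k x)
    exact BddMeas.select (fun x' : S × A => h2 x'.1) (hZ.adapted (k + 1))

theorem BddMeas.noise {m : MeasurableSpace Ω} (M : MAMDP N S A) (d : S × A → ℝ) (τ : ℕ)
    {q : Ω → S × A → ℝ} (h : ∀ y, BddMeas m fun ω => q ω y) (x x' y : S × A) :
    BddMeas m fun ω => noise M K d τ (q ω) x x' y :=
  (BddMeas.ite _ ((BddMeas.tdTarget M h x x'.1).sub (BddMeas.bellman M h x))
    (BddMeas.const 0)).add (((BddMeas.bellman M h y).sub (h y)).mul (BddMeas.const _))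

theorem BddMeas.noise_step (hZ : IsMarkovChain μ ℱ K Z) (M : MAMDP N S A) (d : S × A → ℝ) (τ : ℕ)
    {k : ℕ} {q : Ω → S × A → ℝ} (h : ∀ y, BddMeas (ℱ k) fun ω => q ω y) (x' y : S × A) :
    BddMeas (ℱ k) fun ω => DistQ.noise M K d τ (q ω) (Z k ω) x' y :=
  BddMeas.select (fun x => BddMeas.noise M d τ h x x' y) (hZ.adapted k)

theorem BddMeas.noise_next (hZ : IsMarkovChain μ ℱ K Z) (M : MAMDP N S A) (d : S × A → ℝ) (τ : ℕ)
    {k : ℕ} {q : Ω → S × A → ℝ} (h : ∀ y, BddMeas (ℱ k) fun ω => q ω y) (y : S × A) :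
    BddMeas (ℱ (k + 1)) fun ω => DistQ.noise M K d τ (q ω) (Z k ω) (Z (k + 1) ω) y :=
  BddMeas.select (fun x' => (BddMeas.noise_step hZ M d τ h x' y).mono (ℱ.mono k.le_succ))
    (hZ.adapted (k + 1))

theorem BddMeas.noiseSum (hZ : IsMarkovChain μ ℱ K Z) (M : MAMDP N S A)
    (W : Matrix (Fin N) (Fin N) ℝ) (α : ℝ) (d : S × A → ℝ) (τ : ℕ) {Q₀ : Ω → Fin N → S × A → ℝ}
    (hQ₀ : ∀ i x, BddMeas (ℱ 0) fun ω => Q₀ ω i x) (k : ℕ) (y : S × A) :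
    BddMeas (ℱ k) fun ω => noiseSum M W α K d τ (Q₀ ω) (fun t => Z t ω) k y := by
  induction k with
  | zero => exact BddMeas.const 0
  | succ k ih =>
    exact ((BddMeas.const _).mul (ih.mono (ℱ.mono k.le_succ))).add ((BddMeas.const _).mul
      (BddMeas.noise_next hZ M d τ (fun y => BddMeas.avg fun i =>
        BddMeas.qIter hZ M W α hQ₀ k i y) y))

theorem BddMeas.corrected (hZ : IsMarkovChain μ ℱ K Z) (M : MAMDP N S A)
    (W : Matrix (Fin N) (Fin N) ℝ) (α : ℝ) (d : S × A → ℝ) (τ : ℕ) {Q₀ : Ω → Fin N → S × A → ℝ}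
    (hQ₀ : ∀ i x, BddMeas (ℱ 0) fun ω => Q₀ ω i x) (k : ℕ) (y : S × A) :
    BddMeas (ℱ k) fun ω => corrected M W α K d τ (Q₀ ω) (fun t => Z t ω) k y := by
  have hq : ∀ y, BddMeas (ℱ k) fun ω => DistQ.avg (DistQ.qIter M W α (Q₀ ω) (fun t => Z t ω) k) y :=
    fun y => BddMeas.avg fun i => BddMeas.qIter hZ M W α hQ₀ k i y
  exact (((hq y).sub (BddMeas.const _)).sub (BddMeas.noiseSum hZ M W α d τ hQ₀ k y)).add
    (((BddMeas.const _).mul ((BddMeas.bellman M hq y).sub (hq y))).mul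
      (BddMeas.select (F := fun x _ => poisson K d τ y x) (fun x => BddMeas.const _)
        (hZ.adapted k)))

end Iterates

/-! ### Second moment of the accumulated noise. -/

section Variance

variable {N : ℕ} {S A Ω : Type*} [Fintype S] [Fintype A] [DecidableEq S] [DecidableEq A]
  {m : MeasurableSpace Ω} {μ : Measure Ω} {ℱ : Filtration ℕ m} {Z : ℕ → Ω → S × A}
  {d : S × A → ℝ}

/-- Both parts are centered: `bellman` is the mean of `tdTarget` over the next state, and
`poissonNext` is the mean of `poisson`. -/
theorem sum_saMatrix_mul_noise (M : MAMDP N S A) {β : S → A → ℝ} (hβ : IsPolicy β) (τ : ℕ)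
    (q : S × A → ℝ) (x y : S × A) :
    ∑ x', saMatrix M β x x' * noise M (saMatrix M β) d τ q x x' y = 0 := by
  have hrow := Matrix.sum_row_of_mem_rowStochastic (saMatrix_mem_rowStochastic M hβ) x
  have h1 : ∑ x', saMatrix M β x x' *
      (if y = x then tdTarget M q x x'.1 - bellman M q x else 0) = 0 := by
    split_ifs
    · have h2 : ∑ x', saMatrix M β x x' * tdTarget M q x x'.1 = bellman M q x :=
        sum_saMatrix_mul M hβ x (tdTarget M q x)
      simp only [mul_sub, Finset.sum_sub_distrib, ← Finset.sum_mul, h2, hrow, one_mul, sub_self]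
    · simp
  have h2 : ∑ x', saMatrix M β x x' * ((bellman M q y - q y) *
      (poisson (saMatrix M β) d τ y x' - poissonNext (saMatrix M β) d τ y x)) = 0 := by
    calc _ = (bellman M q y - q y) * (∑ x', saMatrix M β x x' * poisson (saMatrix M β) d τ y x' -
          (∑ x', saMatrix M β x x') * poissonNext (saMatrix M β) d τ y x) := by
          rw [Finset.sum_mul, ← Finset.sum_sub_distrib, Finset.mul_sum]
          exact Finset.sum_congr rfl fun x' _ => by ring
      _ = 0 := by rw [hrow, poissonNext]; ring
  simp only [noise, mul_add, Finset.sum_add_distrib, h1, h2, add_zero]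

variable [Nonempty A]

/-- The sampling noise lives in the single coordinate `y = x`, so it contributes once to the sum
over all pairs. -/
theorem sum_sq_noise_le (M : MAMDP N S A) (hN : N ≠ 0) {R : ℝ}
    (hr : ∀ i s a s', |M.r i s a s'| ≤ R) (K : Matrix (S × A) (S × A) ℝ) (τ : ℕ)
    (q : S × A → ℝ) (hq : ∀ x, |q x| ≤ R / (1 - M.γ)) (x x' : S × A) :
    ∑ y, noise M K d τ q x x' y ^ 2 ≤ 8 * (R / (1 - M.γ)) ^ 2 *
      (1 + ∑ y, (poisson K d τ y x' - poissonNext K d τ y x) ^ 2) := by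
  set R' := R / (1 - M.γ) with hR'
  have hsq : ∀ a b : ℝ, |a| ≤ R' → |b| ≤ R' → (a - b) ^ 2 ≤ 4 * R' ^ 2 := by
    intro a b ha hb
    have h : |a - b| ≤ 2 * R' := (abs_sub _ _).trans (by linarith)
    calc (a - b) ^ 2 ≤ (2 * R') ^ 2 := sq_le_sq' (abs_le.1 h).1 (abs_le.1 h).2
      _ = _ := by ring
  calc ∑ y, noise M K d τ q x x' y ^ 2
      ≤ ∑ y, ((if y = x then 8 * R' ^ 2 else 0) +
          8 * R' ^ 2 * (poisson K d τ y x' - poissonNext K d τ y x) ^ 2) := by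
        refine Finset.sum_le_sum fun y _ => ?_
        have h1 : ∀ a b : ℝ, (a + b) ^ 2 ≤ 2 * a ^ 2 + 2 * b ^ 2 := fun a b => by
          linarith [sq_nonneg (a - b), sub_sq a b, add_sq a b]
        refine (h1 _ _).trans (add_le_add ?_ ?_)
        · split_ifs
          · linarith [hsq _ _ (abs_tdTarget_le M hN hr q hq x x'.1) (abs_bellman_le M hN hr q hq x)]
          · norm_num
        · rw [mul_pow]
          have h2 := mul_le_mul_of_nonneg_right
            (hsq _ _ (abs_bellman_le M hN hr q hq y) (hq y))
            (sq_nonneg (poisson K d τ y x' - poissonNext K d τ y x))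
          linarith
    _ = _ := by
        rw [Finset.sum_add_distrib, ← Finset.mul_sum]
        simp
        ring

variable [IsProbabilityMeasure μ]

theorem integral_mul_noise (M : MAMDP N S A) {β : S → A → ℝ} (hβ : IsPolicy β)
    (hZ : IsMarkovChain μ ℱ (saMatrix M β) Z) (τ k : ℕ) {u : Ω → ℝ} (hu : BddMeas (ℱ k) u)
    {q : Ω → S × A → ℝ} (hq : ∀ y, BddMeas (ℱ k) fun ω => q ω y) (y : S × A) :
    ∫ ω, u ω * noise M (saMatrix M β) d τ (q ω) (Z k ω) (Z (k + 1) ω) y ∂μ = 0 := by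
  rw [hZ.integral_next k
    (Φ := fun x' ω => u ω * noise M (saMatrix M β) d τ (q ω) (Z k ω) x' y)
    fun x' => hu.mul (BddMeas.noise_step hZ M d τ hq x' y)]
  refine integral_eq_zero_of_ae (ae_of_all _ fun ω => ?_)
  simp only [mul_left_comm, ← Finset.mul_sum, sum_saMatrix_mul_noise M hβ, mul_zero, Pi.zero_apply]

theorem integral_sum_sq_noise_le (M : MAMDP N S A) (hN : N ≠ 0) {R : ℝ}
    (hr : ∀ i s a s', |M.r i s a s'| ≤ R) {β : S → A → ℝ} (hβ : IsPolicy β)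
    (hZ : IsMarkovChain μ ℱ (saMatrix M β) Z) (hd0 : ∀ x, 0 ≤ d x) (hd1 : ∀ x, d x ≤ 1)
    {τ : ℕ} (hτ : 1 ≤ τ) (k : ℕ)
    {q : Ω → S × A → ℝ} (hq : ∀ y, BddMeas (ℱ k) fun ω => q ω y)
    (hqR : ∀ ω x, |q ω x| ≤ R / (1 - M.γ)) :
    ∫ ω, ∑ y, noise M (saMatrix M β) d τ (q ω) (Z k ω) (Z (k + 1) ω) y ^ 2 ∂μ ≤
      8 * (R / (1 - M.γ)) ^ 2 *
        (∫ ω, ∑ y, poisson (saMatrix M β) d τ y (Z (k + 1) ω) ^ 2 ∂μ -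
          ∫ ω, ∑ y, poisson (saMatrix M β) d τ y (Z k ω) ^ 2 ∂μ + 5 * τ) := by
  have hK := saMatrix_mem_rowStochastic M hβ
  have hsel : ∀ (j : ℕ) (f : S × A → ℝ), BddMeas m fun ω => f (Z j ω) := fun j f =>
    (BddMeas.select (F := fun x _ => f x) (fun x => BddMeas.const _) (hZ.adapted j)).mono (ℱ.le j)
  have hB : BddMeas m fun ω => ∑ y, (poisson (saMatrix M β) d τ y (Z (k + 1) ω) -
      poissonNext (saMatrix M β) d τ y (Z k ω)) ^ 2 :=
    BddMeas.sum _ fun y => ((hsel (k + 1) _).sub (hsel k _)).sq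
  have h1 : ∫ ω, ∑ y, noise M (saMatrix M β) d τ (q ω) (Z k ω) (Z (k + 1) ω) y ^ 2 ∂μ ≤
      ∫ ω, 8 * (R / (1 - M.γ)) ^ 2 * (1 + ∑ y, (poisson (saMatrix M β) d τ y (Z (k + 1) ω) -
        poissonNext (saMatrix M β) d τ y (Z k ω)) ^ 2) ∂μ :=
    integral_mono (BddMeas.sum _ fun y =>
      ((BddMeas.noise_next hZ M d τ hq y).mono (ℱ.le (k + 1))).sq).integrable
      ((BddMeas.const _).mul ((BddMeas.const 1).add hB)).integrable
      fun ω => sum_sq_noise_le M hN hr _ τ (q ω) (hqR ω) _ _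
  rw [integral_const_mul, integral_add (integrable_const _) hB.integrable] at h1
  refine h1.trans (mul_le_mul_of_nonneg_left ?_ (by positivity))
  have h2 := integral_sum_sq_poisson_sub_le (d := d) hZ hK hd0 hd1 τ k
  have h3 : (1 : ℝ) ≤ τ := by exact_mod_cast hτ
  simp only [integral_const, probReal_univ, smul_eq_mul, mul_one]
  linarith

/-- The induction carries the potential `α ^ 2` times the second moment of `poisson`, which absorbs
the telescoping part of the noise bound and leaves a source `5 τ α ^ 2` against the damping `1 - α
dmin`. -/
theorem integral_sum_sq_noiseSum_le (M : MAMDP N S A) (hN : N ≠ 0) {R : ℝ}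
    (hr : ∀ i s a s', |M.r i s a s'| ≤ R) {β : S → A → ℝ} (hβ : IsPolicy β)
    (hZ : IsMarkovChain μ ℱ (saMatrix M β) Z) (hd0 : ∀ x, 0 ≤ d x) (hd1 : ∀ x, d x ≤ 1)
    {dmin : ℝ} (hdmin0 : 0 < dmin) (hdmin : ∀ x, dmin ≤ d x)
    {W : Matrix (Fin N) (Fin N) ℝ} (hW : W ∈ doublyStochastic ℝ (Fin N)) {α : ℝ} (hα : 0 ≤ α)
    (hα1 : α ≤ 1) (hαW : ∀ i, α ≤ W i i) {τ : ℕ} (hτ : 1 ≤ τ)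
    {Q₀ : Ω → Fin N → S × A → ℝ} (hQ₀ : ∀ i x, BddMeas (ℱ 0) fun ω => Q₀ ω i x)
    (hQ₀R : ∀ ω i x, |Q₀ ω i x| ≤ R / (1 - M.γ)) (k : ℕ) :
    ∫ ω, ∑ y, noiseSum M W α (saMatrix M β) d τ (Q₀ ω) (fun t => Z t ω) k y ^ 2 ∂μ ≤
      8 * (R / (1 - M.γ)) ^ 2 * (α ^ 2 *
        ∫ ω, ∑ y, poisson (saMatrix M β) d τ y (Z k ω) ^ 2 ∂μ + 5 * (α * τ) / dmin) := by
  set R' := R / (1 - M.γ) with hR'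
  have hsel : ∀ (j : ℕ) (f : S × A → ℝ), BddMeas m fun ω => f (Z j ω) := fun j f =>
    (BddMeas.select (F := fun x _ => f x) (fun x => BddMeas.const _) (hZ.adapted j)).mono (ℱ.le j)
  induction k with
  | zero =>
    simp only [noiseSum, Pi.zero_apply, ne_eq, OfNat.ofNat_ne_zero, not_false_eq_true, zero_pow,
      Finset.sum_const_zero, integral_zero]
    have : 0 ≤ ∫ ω, ∑ y, poisson (saMatrix M β) d τ y (Z 0 ω) ^ 2 ∂μ :=
      integral_nonneg fun ω => Finset.sum_nonneg fun y _ => sq_nonneg _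
    positivity
  | succ k ih =>
    set u : Ω → S × A → ℝ := fun ω =>
      noiseSum M W α (saMatrix M β) d τ (Q₀ ω) (fun t => Z t ω) k with hu
    set q : Ω → S × A → ℝ := fun ω => avg (qIter M W α (Q₀ ω) (fun t => Z t ω) k) with hq
    set ξ : Ω → S × A → ℝ := fun ω =>
      noise M (saMatrix M β) d τ (q ω) (Z k ω) (Z (k + 1) ω) with hξ
    have hqB : ∀ y, BddMeas (ℱ k) fun ω => q ω y := fun y =>
      BddMeas.avg fun i => BddMeas.qIter hZ M W α hQ₀ k i y
    have hqR : ∀ ω x, |q ω x| ≤ R' := fun ω x => abs_avg_le hN _ _ _ fun i =>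
      abs_qIter_le M hr hW hα hαW (Q₀ ω) (hQ₀R ω) _ k i x
    have huB : ∀ y, BddMeas (ℱ k) fun ω => u ω y := fun y =>
      BddMeas.noiseSum hZ M W α d τ hQ₀ k y
    have huBm := fun y => (huB y).mono (ℱ.le k)
    have hξB : ∀ y, BddMeas m fun ω => ξ ω y := fun y =>
      (BddMeas.noise_next hZ M d τ hqB y).mono (ℱ.le (k + 1))
    have hstep : ∀ y, ∫ ω, ((1 - α * d y) * u ω y + α * ξ ω y) ^ 2 ∂μ ≤
        (1 - α * dmin) * ∫ ω, u ω y ^ 2 ∂μ + α ^ 2 * ∫ ω, ξ ω y ^ 2 ∂μ := by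
      intro y
      have b1 := (BddMeas.const (m := m) ((1 - α * d y) ^ 2)).mul (huBm y).sq
      have b2 := (BddMeas.const (m := m) (2 * (1 - α * d y) * α)).mul ((huBm y).mul (hξB y))
      have b3 := (BddMeas.const (m := m) (α ^ 2)).mul (hξB y).sq
      have heq : ∫ ω, ((1 - α * d y) * u ω y + α * ξ ω y) ^ 2 ∂μ =
          (1 - α * d y) ^ 2 * ∫ ω, u ω y ^ 2 ∂μ + α ^ 2 * ∫ ω, ξ ω y ^ 2 ∂μ := by
        calc ∫ ω, ((1 - α * d y) * u ω y + α * ξ ω y) ^ 2 ∂μ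
            = ∫ ω, ((1 - α * d y) ^ 2 * u ω y ^ 2 +
              2 * (1 - α * d y) * α * (u ω y * ξ ω y) + α ^ 2 * ξ ω y ^ 2) ∂μ := by
              congr 1; ext ω; ring
          _ = _ := by
            rw [integral_add (b1.add b2).integrable b3.integrable,
              integral_add b1.integrable b2.integrable, integral_const_mul, integral_const_mul,
              integral_const_mul, integral_mul_noise M hβ hZ τ k (huB y) hqB y, mul_zero,
              add_zero]
      -- The cross term has vanished, and squaring the damping factor only helps: `(1 - α d y) ^ 2 ≤
      -- 1 - α d y`.
      rw [heq]
      refine add_le_add_left (mul_le_mul_of_nonneg_right ?_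
        (integral_nonneg fun ω => sq_nonneg _)) _
      have h1 : α * d y ≤ 1 := mul_le_one₀ hα1 (hd0 y) (hd1 y)
      have h2 : 0 ≤ α * d y := mul_nonneg hα (hd0 y)
      have h3 : α * dmin ≤ α * d y := mul_le_mul_of_nonneg_left (hdmin y) hα
      nlinarith
    have hsum : ∫ ω, ∑ y, ((1 - α * d y) * u ω y + α * ξ ω y) ^ 2 ∂μ ≤
        (1 - α * dmin) * ∫ ω, ∑ y, u ω y ^ 2 ∂μ + α ^ 2 * ∫ ω, ∑ y, ξ ω y ^ 2 ∂μ := by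
      rw [integral_finsetSum _ fun y _ => (((BddMeas.const _).mul (huBm y)).add
          ((BddMeas.const _).mul (hξB y))).sq.integrable,
        integral_finsetSum _ fun y _ => (huBm y).sq.integrable,
        integral_finsetSum _ fun y _ => (hξB y).sq.integrable, Finset.mul_sum, Finset.mul_sum,
        ← Finset.sum_add_distrib]
      exact Finset.sum_le_sum fun y _ => hstep y
    have hξS := integral_sum_sq_noise_le M hN hr hβ hZ hd0 hd1 hτ k hqB hqR
    set V := ∫ ω, ∑ y, u ω y ^ 2 ∂μ
    set a := ∫ ω, ∑ y, poisson (saMatrix M β) d τ y (Z k ω) ^ 2 ∂μ with ha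
    set a' := ∫ ω, ∑ y, poisson (saMatrix M β) d τ y (Z (k + 1) ω) ^ 2 ∂μ
    have ha0 : 0 ≤ a := integral_nonneg fun ω => Finset.sum_nonneg fun y _ => sq_nonneg _
    refine hsum.trans ?_
    have hαd : α * dmin ≤ 1 := by
      obtain ⟨ω⟩ : Nonempty Ω := μ.nonempty_of_neZero
      exact mul_le_one₀ hα1 hdmin0.le ((hdmin (Z 0 ω)).trans (hd1 _))
    have e1 : (1 - α * dmin) * V ≤
        (1 - α * dmin) * (8 * R' ^ 2 * (α ^ 2 * a + 5 * (α * τ) / dmin)) :=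
      mul_le_mul_of_nonneg_left ih (by linarith)
    have e2 := mul_le_mul_of_nonneg_left hξS (sq_nonneg α)
    -- The damping of `5 α τ / dmin` frees exactly the `5 τ α ^ 2` added in this step.
    have e3 : (1 - α * dmin) * (8 * R' ^ 2 * (α ^ 2 * a + 5 * (α * τ) / dmin)) =
        8 * R' ^ 2 * (α ^ 2 * a + 5 * (α * τ) / dmin) - 8 * R' ^ 2 * (α * dmin * (α ^ 2 * a)) -
        8 * R' ^ 2 * (α ^ 2 * (5 * τ)) := by
      field_simp
      ring
    have e4 : 0 ≤ 8 * R' ^ 2 * (α * dmin * (α ^ 2 * a)) := by positivity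
    linarith

theorem integral_norm_noiseSum_le (M : MAMDP N S A) (hN : N ≠ 0) {R : ℝ} (hR : 0 ≤ R)
    (hr : ∀ i s a s', |M.r i s a s'| ≤ R) {β : S → A → ℝ} (hβ : IsPolicy β)
    (hZ : IsMarkovChain μ ℱ (saMatrix M β) Z) (hd0 : ∀ x, 0 ≤ d x) (hd1 : ∀ x, d x ≤ 1)
    (hds : ∑ x, d x = 1)
    {dmin : ℝ} (hdmin0 : 0 < dmin) (hdmin : ∀ x, dmin ≤ d x)
    {W : Matrix (Fin N) (Fin N) ℝ} (hW : W ∈ doublyStochastic ℝ (Fin N)) {α : ℝ} (hα : 0 ≤ α)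
    (hα1 : α ≤ 1) (hαW : ∀ i, α ≤ W i i) {τ : ℕ} (hτ : 1 ≤ τ) (hατ : α * τ ≤ 1 / 2)
    {Q₀ : Ω → Fin N → S × A → ℝ} (hQ₀ : ∀ i x, BddMeas (ℱ 0) fun ω => Q₀ ω i x)
    (hQ₀R : ∀ ω i x, |Q₀ ω i x| ≤ R / (1 - M.γ)) (k : ℕ) :
    ∫ ω, ‖noiseSum M W α (saMatrix M β) d τ (Q₀ ω) (fun t => Z t ω) k‖ ∂μ ≤
      7 * (R / (1 - M.γ)) * √(α * τ / dmin) := by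
  have hγ1 := M.γ_lt_one
  have hR' : 0 ≤ R / (1 - M.γ) := div_nonneg hR (by linarith)
  have hK := saMatrix_mem_rowStochastic M hβ
  have hu : ∀ y, BddMeas m fun ω =>
      noiseSum M W α (saMatrix M β) d τ (Q₀ ω) (fun t => Z t ω) k y := fun y =>
    (BddMeas.noiseSum hZ M W α d τ hQ₀ k y).mono (ℱ.le k)
  have h1 := integral_sum_sq_noiseSum_le M hN hr hβ hZ hd0 hd1 hdmin0 hdmin hW hα hα1 hαW hτ hQ₀
    hQ₀R k
  have h2 : ∫ ω, ∑ y, poisson (saMatrix M β) d τ y (Z k ω) ^ 2 ∂μ ≤ 2 * (τ : ℝ) ^ 2 := by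
    refine (integral_mono (g := fun _ => 2 * (τ : ℝ) ^ 2) (BddMeas.sum _ fun y => BddMeas.sq <|
      (BddMeas.select (F := fun x _ => poisson (saMatrix M β) d τ y x)
        (fun x => BddMeas.const _) (hZ.adapted k)).mono (ℱ.le k)).integrable (integrable_const _)
      fun ω => sum_poisson_sq_le hK hd0 hd1 hds τ _).trans (by simp)
  have h3 := sq_integral_le (μ := μ) (BddMeas.norm hu)
  have h4 : ∫ ω, ‖noiseSum M W α (saMatrix M β) d τ (Q₀ ω) (fun t => Z t ω) k‖ ^ 2 ∂μ ≤
      ∫ ω, ∑ y, noiseSum M W α (saMatrix M β) d τ (Q₀ ω) (fun t => Z t ω) k y ^ 2 ∂μ := by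
    refine integral_mono (BddMeas.norm hu).sq.integrable
      (BddMeas.sum _ fun y => (hu y).sq).integrable fun ω => ?_
    -- The sup norm is at most the Euclidean norm, which the second moment controls.
    have hs : 0 ≤ ∑ y, noiseSum M W α (saMatrix M β) d τ (Q₀ ω) (fun t => Z t ω) k y ^ 2 :=
      Finset.sum_nonneg fun y _ => sq_nonneg _
    have h5 : ‖noiseSum M W α (saMatrix M β) d τ (Q₀ ω) (fun t => Z t ω) k‖ ≤
        √(∑ y, noiseSum M W α (saMatrix M β) d τ (Q₀ ω) (fun t => Z t ω) k y ^ 2) :=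
      (pi_norm_le_iff_of_nonneg (Real.sqrt_nonneg _)).2 fun y => Real.abs_le_sqrt
        (Finset.single_le_sum (f := fun y =>
          noiseSum M W α (saMatrix M β) d τ (Q₀ ω) (fun t => Z t ω) k y ^ 2)
          (fun y _ => sq_nonneg _) (Finset.mem_univ y))
    exact (pow_le_pow_left₀ (norm_nonneg _) h5 2).trans (Real.sq_sqrt hs).le
  have hd1' : dmin ≤ 1 := by
    obtain ⟨ω⟩ : Nonempty Ω := μ.nonempty_of_neZero
    exact (hdmin (Z 0 ω)).trans (hd1 _)
  -- Here `α τ ≤ 1 / 2` makes the quadratic potential term at most linear in `α τ`.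
  have h6 : α ^ 2 * (2 * (τ : ℝ) ^ 2) ≤ α * τ / dmin := by
    have hx : 0 ≤ α * (τ : ℝ) := by positivity
    rw [le_div_iff₀ hdmin0]
    calc α ^ 2 * (2 * (τ : ℝ) ^ 2) * dmin ≤ α ^ 2 * (2 * (τ : ℝ) ^ 2) * 1 :=
          mul_le_mul_of_nonneg_left hd1' (by positivity)
      _ = 2 * (α * τ) * (α * τ) := by ring
      _ ≤ 1 * (α * τ) := mul_le_mul_of_nonneg_right (by linarith) hx
      _ = _ := one_mul _
  have hX : 0 ≤ α * τ / dmin := by positivity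
  have h7 : (∫ ω, ‖noiseSum M W α (saMatrix M β) d τ (Q₀ ω) (fun t => Z t ω) k‖ ∂μ) ^ 2 ≤
      (7 * (R / (1 - M.γ)) * √(α * τ / dmin)) ^ 2 := by
    rw [mul_pow, Real.sq_sqrt hX]
    refine (h3.trans (h4.trans h1)).trans ?_
    -- The total is `8 * (1 + 5) = 48`, rounded up to `7 ^ 2`.
    calc _ ≤ 8 * (R / (1 - M.γ)) ^ 2 * (α * τ / dmin + 5 * (α * τ / dmin)) := by
          refine mul_le_mul_of_nonneg_left (add_le_add
            ((mul_le_mul_of_nonneg_left h2 (sq_nonneg α)).trans h6) (le_of_eq ?_)) (by positivity)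
          ring
      _ = 48 * ((R / (1 - M.γ)) ^ 2 * (α * τ / dmin)) := by ring
      _ ≤ 49 * ((R / (1 - M.γ)) ^ 2 * (α * τ / dmin)) :=
          mul_le_mul_of_nonneg_right (by norm_num) (by positivity)
      _ = _ := by ring
  exact (abs_le_of_sq_le_sq' h7 (by positivity)).2

end Variance

/-! ### Scalar recursions with a geometric source. -/

theorem le_of_le_mul_add_geom {ρ σ α κ a b c : ℝ} (hρ : ρ = 1 - α * κ) (hρ0 : 0 ≤ ρ) (hκ : 0 < κ)
    (hb : 0 ≤ b) {f : ℕ → ℝ} (h0 : f 0 ≤ a)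
    (h : ∀ k, f (k + 1) ≤ ρ * f k + α * (b + σ ^ k * c)) (k : ℕ) :
    f k ≤ ρ ^ k * a + b / κ + c * (α * ∑ j ∈ Finset.range k, ρ ^ (k - 1 - j) * σ ^ j) := by
  induction k with
  | zero => simpa using h0.trans (le_add_of_nonneg_right (by positivity))
  | succ k ih =>
    have hs : ∑ j ∈ Finset.range (k + 1), ρ ^ (k + 1 - 1 - j) * σ ^ j =
        ρ * ∑ j ∈ Finset.range k, ρ ^ (k - 1 - j) * σ ^ j + σ ^ k := by
      rw [Finset.sum_range_succ, Finset.mul_sum]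
      congr 1
      · refine Finset.sum_congr rfl fun j hj => ?_
        have hj' := Finset.mem_range.1 hj
        rw [show k + 1 - 1 - j = (k - 1 - j) + 1 by omega, pow_succ]
        ring
      · simp
    rw [hs]
    calc f (k + 1) ≤ ρ * f k + α * (b + σ ^ k * c) := h k
      _ ≤ ρ * (ρ ^ k * a + b / κ + c * (α * ∑ j ∈ Finset.range k, ρ ^ (k - 1 - j) * σ ^ j)) +
          α * (b + σ ^ k * c) := by gcongr
      _ = _ := by
          have : ρ * (b / κ) + α * b = b / κ := by rw [hρ]; field_simp; ring
          linear_combination this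

/-- In each product one exponent is about `k / 2` or more: that factor is bounded by its power, and
the other is summed as a geometric series. -/
theorem geom_convolution_le {ρ σ α κ : ℝ} (hρ : ρ = 1 - α * κ) (hρ0 : 0 ≤ ρ) (hρ1 : ρ ≤ 1)
    (hκ : 0 < κ) (hα : 0 ≤ α) (hα1 : α ≤ 1) (hσ0 : 0 ≤ σ) (hσ1 : σ < 1) {τ k : ℕ} (hτ : 1 ≤ τ)
    (hk : τ ≤ k) :
    α * ∑ j ∈ Finset.range k, ρ ^ (k - 1 - j) * σ ^ j ≤
      ρ ^ (((k : ℝ) - τ) / 2) * (1 / (1 - σ)) + σ ^ (((k : ℝ) - τ) / 4) * (1 / κ) := by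
  have h1 : 0 < 1 - σ := by linarith
  have hτ' : (1 : ℝ) ≤ τ := by exact_mod_cast hτ
  have hk' : (τ : ℝ) ≤ k := by exact_mod_cast hk
  set A := ρ ^ (((k : ℝ) - τ) / 2) with hA
  set B := σ ^ (((k : ℝ) - τ) / 4) with hB
  have hA0 : 0 ≤ A := Real.rpow_nonneg hρ0 _
  have hB0 : 0 ≤ B := Real.rpow_nonneg hσ0 _
  have hterm : ∀ j ∈ Finset.range k, ρ ^ (k - 1 - j) * σ ^ j ≤ A * σ ^ j + B * ρ ^ (k - 1 - j) := by
    intro j hj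
    have hj' : j + 1 ≤ k := Finset.mem_range.1 hj
    have hpσ : 0 ≤ σ ^ j := pow_nonneg hσ0 _
    have hpρ : 0 ≤ ρ ^ (k - 1 - j) := pow_nonneg hρ0 _
    -- In the first case `k - 1 - j ≥ (k - 1) / 2 ≥ (k - τ) / 2`, which needs `τ ≥ 1`; in the
    -- second, `j ≥ k / 2 ≥ (k - τ) / 4`.
    by_cases hjk : 2 * j + 1 ≤ k
    · have hc : ((k - 1 - j : ℕ) : ℝ) = k - 1 - j := by
        rw [Nat.sub_sub, Nat.cast_sub (by omega)]; push_cast; ring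
      have hjk' : 2 * (j : ℝ) + 1 ≤ k := by exact_mod_cast hjk
      have : ρ ^ (k - 1 - j) ≤ A := by
        rw [← Real.rpow_natCast, hc]
        exact Real.rpow_le_rpow_of_exponent_ge' hρ0 hρ1 (by linarith) (by linarith)
      exact (mul_le_mul_of_nonneg_right this hpσ).trans
        (le_add_of_nonneg_right (mul_nonneg hB0 hpρ))
    · have hjk' : (k : ℝ) ≤ 2 * (j : ℝ) := by exact_mod_cast (by omega : k ≤ 2 * j)
      have : σ ^ j ≤ B := by
        rw [← Real.rpow_natCast]
        exact Real.rpow_le_rpow_of_exponent_ge' hσ0 hσ1.le (by linarith) (by linarith)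
      rw [mul_comm]
      exact (mul_le_mul_of_nonneg_right this hpρ).trans
        (le_add_of_nonneg_left (mul_nonneg hA0 hpσ))
  have hs1 : ∑ j ∈ Finset.range k, σ ^ j ≤ 1 / (1 - σ) := by
    rw [le_div_iff₀ h1, geom_sum_mul_neg]
    linarith [pow_nonneg hσ0 k]
  have hs2 : α * ∑ j ∈ Finset.range k, ρ ^ (k - 1 - j) ≤ 1 / κ := by
    rw [Finset.sum_range_reflect (fun j => ρ ^ j), le_div_iff₀ hκ]
    have := geom_sum_mul_neg ρ k
    calc α * (∑ j ∈ Finset.range k, ρ ^ j) * κ = (∑ j ∈ Finset.range k, ρ ^ j) * (1 - ρ) := by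
          rw [hρ]; ring
      _ ≤ 1 := by rw [this]; linarith [pow_nonneg hρ0 k]
  calc α * ∑ j ∈ Finset.range k, ρ ^ (k - 1 - j) * σ ^ j
      ≤ α * ∑ j ∈ Finset.range k, (A * σ ^ j + B * ρ ^ (k - 1 - j)) :=
        mul_le_mul_of_nonneg_left (Finset.sum_le_sum hterm) hα
    _ = α * (A * ∑ j ∈ Finset.range k, σ ^ j) +
        B * (α * ∑ j ∈ Finset.range k, ρ ^ (k - 1 - j)) := by
        rw [Finset.sum_add_distrib, ← Finset.mul_sum, ← Finset.mul_sum]; ring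
    _ ≤ A * (1 / (1 - σ)) + B * (1 / κ) := by
        refine add_le_add ?_ (mul_le_mul_of_nonneg_left hs2 hB0)
        refine (mul_le_of_le_one_left ?_ hα1).trans (mul_le_mul_of_nonneg_left hs1 hA0)
        exact mul_nonneg hA0 (Finset.sum_nonneg fun j _ => pow_nonneg hσ0 _)

/-! ### The expected error before simplification of the constants. -/

section Expectation

variable {N : ℕ} {S A Ω : Type*} [Fintype S] [Fintype A] [DecidableEq S] [DecidableEq A]
  [Nonempty A] {m : MeasurableSpace Ω} {μ : Measure Ω} [IsProbabilityMeasure μ]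
  {ℱ : Filtration ℕ m} {Z : ℕ → Ω → S × A} {d : S × A → ℝ}

/-- Integrate the pathwise contraction of `corrected`. Constant sources are divided by the rate `(1
- γ) dmin`, the decaying disagreement becomes the convolution, and `noiseSum` is then added back. -/
theorem integral_norm_error_le (M : MAMDP N S A) (hN : N ≠ 0) {R : ℝ} (hR : 0 ≤ R)
    (hr : ∀ i s a s', |M.r i s a s'| ≤ R) {β : S → A → ℝ} (hβ : IsPolicy β)
    (hZ : IsMarkovChain μ ℱ (saMatrix M β) Z) (hd0 : ∀ x, 0 ≤ d x) (hd1 : ∀ x, d x ≤ 1)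
    (hds : ∑ x, d x = 1) {dmin dmax : ℝ} (hdmin0 : 0 < dmin) (hdmin : ∀ x, dmin ≤ d x)
    (hdmax : ∀ x, d x ≤ dmax)
    {W : Matrix (Fin N) (Fin N) ℝ} (hW : W ∈ doublyStochastic ℝ (Fin N)) (hσ1 : sigma2 W < 1)
    (hσ : ∀ v : EuclideanSpace ℝ (Fin N), ∑ i, v i = 0 →
      ‖Matrix.toEuclideanLin W v‖ ≤ sigma2 W * ‖v‖) {α : ℝ} (hα : 0 ≤ α)
    (hα1 : α ≤ 1) (hαW : ∀ i, α ≤ W i i) {τ : ℕ} (hτ : 1 ≤ τ) (hατ : α * τ ≤ 1 / 2)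
    (hmix : MixedAt (saMatrix M β) d α τ)
    {Q₀ : Ω → Fin N → S × A → ℝ} (hQ₀ : ∀ i x, BddMeas (ℱ 0) fun ω => Q₀ ω i x)
    (hQ₀R : ∀ ω i x, |Q₀ ω i x| ≤ R / (1 - M.γ)) {k : ℕ} (hk : τ ≤ k) :
    ∫ ω, ‖avg (qIter M W α (Q₀ ω) (fun t => Z t ω) k) - optimalQ M‖ ∂μ ≤
      R / (1 - M.γ) * (3 + √N / (1 - sigma2 W) + √N / ((1 - M.γ) * dmin)) *
        ((1 - α * (1 - M.γ) * dmin) ^ (((k : ℝ) - τ) / 2) + sigma2 W ^ (((k : ℝ) - τ) / 4)) +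
      R / (1 - M.γ) * (7 * √(α * τ / dmin) * (1 + dmax / ((1 - M.γ) * dmin)) +
        14 * (α * τ / ((1 - M.γ) * dmin)) +
        2 * (α * √N / ((1 - M.γ) * dmin * (1 - sigma2 W)))) := by
  have hγ0 := M.γ_nonneg
  have hγ1 := M.γ_lt_one
  have h1γ : 0 < 1 - M.γ := by linarith
  have hK := saMatrix_mem_rowStochastic M hβ
  obtain ⟨ω₀⟩ : Nonempty Ω := μ.nonempty_of_neZero
  have hdmin1 : dmin ≤ 1 := (hdmin (Z 0 ω₀)).trans (hd1 _)
  have hdmax0 : 0 ≤ dmax := (hd0 (Z 0 ω₀)).trans (hdmax _)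
  set R' := R / (1 - M.γ) with hR'
  have hR0 : 0 ≤ R' := div_nonneg hR h1γ.le
  set σ := sigma2 W with hσdef
  have hσ0 : 0 ≤ σ := sigma2_nonneg W
  have h1σ : 0 < 1 - σ := by linarith
  set κ := (1 - M.γ) * dmin with hκ
  have hκ0 : 0 < κ := mul_pos h1γ hdmin0
  have hκ1 : κ ≤ 1 := mul_le_one₀ (by linarith) hdmin0.le hdmin1
  have hρeq : 1 - α * (1 - M.γ) * dmin = 1 - α * κ := by rw [hκ]; ring
  rw [hρeq]
  set ρ := 1 - α * κ with hρ
  have hρ0 : 0 ≤ ρ := by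
    have := mul_le_one₀ hα1 hκ0.le hκ1
    linarith
  have hρ1 : ρ ≤ 1 := by
    have := mul_nonneg hα hκ0.le
    linarith
  set u := fun (k : ℕ) ω => noiseSum M W α (saMatrix M β) d τ (Q₀ ω) (fun t => Z t ω) k with hu
  set v := fun (k : ℕ) ω => corrected M W α (saMatrix M β) d τ (Q₀ ω) (fun t => Z t ω) k with hv
  have huB : ∀ k, BddMeas m fun ω => ‖u k ω‖ := fun k => BddMeas.norm fun y =>
    (BddMeas.noiseSum hZ M W α d τ hQ₀ k y).mono (ℱ.le k)
  have hvB : ∀ k, BddMeas m fun ω => ‖v k ω‖ := fun k => BddMeas.norm fun y =>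
    (BddMeas.corrected hZ M W α d τ hQ₀ k y).mono (ℱ.le k)
  have hQi := fun ω k => abs_qIter_le M hr hW hα hαW (Q₀ ω) (hQ₀R ω) (fun t => Z t ω) k
  have hqR : ∀ ω k y, |avg (qIter M W α (Q₀ ω) (fun t => Z t ω) k) y| ≤ R' := fun ω k y =>
    abs_avg_le hN _ _ _ fun i => hQi ω k i y
  have hEB : BddMeas m fun ω => ‖avg (qIter M W α (Q₀ ω) (fun t => Z t ω) k) - optimalQ M‖ :=
    BddMeas.norm fun y => BddMeas.sub ((BddMeas.avg fun i =>
      BddMeas.qIter hZ M W α hQ₀ k i y).mono (ℱ.le k)) (BddMeas.const _)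
  set U := 7 * R' * √(α * τ / dmin) with hU
  have hU0 : 0 ≤ U := by positivity
  have huU : ∀ k, ∫ ω, ‖u k ω‖ ∂μ ≤ U := fun k =>
    integral_norm_noiseSum_le M hN hR hr hβ hZ hd0 hd1 hds hdmin0 hdmin hW hα hα1 hαW hτ hατ hQ₀
      hQ₀R k
  set b := dmax * U + 12 * (α * τ * R') + α * (√N * (2 * R')) / (1 - σ) with hb
  have hb0 : 0 ≤ b := by positivity
  have hstep : ∀ k, ∫ ω, ‖v (k + 1) ω‖ ∂μ ≤
      ρ * ∫ ω, ‖v k ω‖ ∂μ + α * (b + σ ^ k * (√N * R')) := by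
    intro k
    set c := σ ^ k * (√N * R') + α * (√N * (2 * R')) / (1 - σ) with hc
    have hpt : ∀ ω, ‖v (k + 1) ω‖ ≤
        ρ * ‖v k ω‖ + α * (dmax * ‖u k ω‖ + (12 * (α * τ * R') + c)) := by
      intro ω
      have h := norm_corrected_succ_le M hN hr hW hα hα1 hαW hK hd0 hd1 hdmin hdmax hτ hmix
        (Q₀ ω) (hQ₀R ω) (fun t => Z t ω) k c fun i y =>
          abs_qIter_sub_avg_le M hN hr hW hσ1 hσ hα hαW (Q₀ ω) (hQ₀R ω) (fun t => Z t ω) k i y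
      rw [hρeq, add_assoc (dmax * _)] at h
      exact h
    have b1 := (BddMeas.const ρ).mul (hvB k)
    have b2 := (BddMeas.const dmax).mul (huB k)
    have b3 := (BddMeas.const α).mul (b2.add (BddMeas.const (12 * (α * τ * R') + c)))
    have hint := integral_mono (μ := μ) (hvB (k + 1)).integrable (b1.add b3).integrable hpt
    rw [integral_add b1.integrable b3.integrable, integral_const_mul, integral_const_mul,
      integral_add b2.integrable (integrable_const _), integral_const_mul] at hint
    simp only [integral_const, probReal_univ, smul_eq_mul, one_mul] at hint
    refine hint.trans (add_le_add_right (mul_le_mul_of_nonneg_left ?_ hα) _)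
    have := mul_le_mul_of_nonneg_left (huU k) hdmax0
    rw [hb, hc]
    linarith
  -- The initial error gives `2 R'`, and the boundary term at most `R'` because `α τ ≤ 1 / 2`.
  have hv0 : ∫ ω, ‖v 0 ω‖ ∂μ ≤ 3 * R' := by
    refine (integral_mono (g := fun _ => 3 * R') (hvB 0).integrable (integrable_const _)
      fun ω => ?_).trans (by simp)
    refine (pi_norm_le_iff_of_nonneg (by positivity)).2 fun y => ?_
    have hq := hqR ω 0
    have ho := abs_optimalQ_le M hN hR hr y
    have hg := abs_bellman_le M hN hr _ hq y
    have hp : |α * (bellman M (avg (qIter M W α (Q₀ ω) (fun t => Z t ω) 0)) y -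
        avg (qIter M W α (Q₀ ω) (fun t => Z t ω) 0) y) *
        poisson (saMatrix M β) d τ y (Z 0 ω)| ≤ α * (2 * R') * τ := by
      rw [abs_mul, abs_mul, abs_of_nonneg hα]
      refine mul_le_mul (mul_le_mul_of_nonneg_left ?_ hα) (abs_poisson_le hK hd0 hd1 τ y _)
        (abs_nonneg _) (by positivity)
      exact (abs_sub _ _).trans (by linarith [hq y])
    have e1 : α * (2 * R') * τ ≤ R' := by
      have := mul_le_mul_of_nonneg_right hατ (by positivity : 0 ≤ 2 * R')
      linarith
    simp only [hv, corrected, noiseSum, Pi.zero_apply, sub_zero, Real.norm_eq_abs]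
    refine (abs_add_le _ _).trans ?_
    have := abs_sub (avg (qIter M W α (Q₀ ω) (fun t => Z t ω) 0) y) (optimalQ M y)
    linarith [hq y]
  have hvk := le_of_le_mul_add_geom (f := fun k => ∫ ω, ‖v k ω‖ ∂μ) hρ hρ0 hκ0 hb0 hv0
    hstep k
  have hconv := geom_convolution_le hρ hρ0 hρ1 hκ0 hα hα1 hσ0 hσ1 hτ hk
  have hE : ∫ ω, ‖avg (qIter M W α (Q₀ ω) (fun t => Z t ω) k) - optimalQ M‖ ∂μ ≤
      ∫ ω, ‖v k ω‖ ∂μ + ∫ ω, ‖u k ω‖ ∂μ + 2 * (α * τ * R') := by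
    have hint := integral_mono (μ := μ) hEB.integrable
      (((hvB k).add (huB k)).add (BddMeas.const (2 * (α * τ * R')))).integrable fun ω =>
        norm_error_le M hN hr (W := W) hα hK hd0 hd1 τ (Q₀ ω) (fun t => Z t ω) k (hqR ω k)
    rw [integral_add ((hvB k).add (huB k)).integrable (integrable_const _),
      integral_add (hvB k).integrable (huB k).integrable] at hint
    simpa using hint
  have hk' : (τ : ℝ) ≤ k := by exact_mod_cast hk
  set P := ρ ^ (((k : ℝ) - τ) / 2) with hP
  set T := σ ^ (((k : ℝ) - τ) / 4) with hT
  have hP0 : 0 ≤ P := Real.rpow_nonneg hρ0 _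
  have hT0 : 0 ≤ T := Real.rpow_nonneg hσ0 _
  have hρk : ρ ^ k ≤ P := by
    rw [← Real.rpow_natCast]
    have : (0 : ℝ) ≤ τ := Nat.cast_nonneg _
    exact Real.rpow_le_rpow_of_exponent_ge' hρ0 hρ1 (by linarith) (by linarith)
  have e1 : ρ ^ k * (3 * R') ≤ P * (3 * R') := mul_le_mul_of_nonneg_right hρk (by positivity)
  have e2 := mul_le_mul_of_nonneg_left hconv (by positivity : 0 ≤ √N * R')
  have e3 : α * τ * R' ≤ α * τ * R' / κ := by
    rw [le_div_iff₀ hκ0]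
    exact mul_le_of_le_one_right (by positivity) hκ1
  have e4 : b / κ = 7 * R' * √(α * τ / dmin) * (dmax / κ) + 12 * (α * τ * R' / κ) +
      R' * (2 * (α * √N / (κ * (1 - σ)))) := by
    rw [hb, hU]; field_simp
  have e5 : 0 ≤ R' * (3 + √N / κ) * T := by positivity
  have e6 : 0 ≤ R' * (√N / (1 - σ)) * T := by positivity
  have e7 : 0 ≤ R' * (√N / κ) * P := by positivity
  have e8 : √N * R' * (P * (1 / (1 - σ)) + T * (1 / κ)) =
      R' * (√N / (1 - σ)) * P + R' * (√N / κ) * T := by ring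
  have e9 : 0 ≤ R' * T := by positivity
  have e10 : R' * (α * τ / κ) = α * τ * R' / κ := by ring
  have e11 : R' * (3 + √N / (1 - σ) + √N / κ) * (P + T) +
      R' * (7 * √(α * τ / dmin) * (1 + dmax / κ) + 14 * (α * τ / κ) +
        2 * (α * √N / (κ * (1 - σ)))) =
      3 * (R' * T) + R' * (√N / (1 - σ)) * T + R' * (√N / κ) * P + P * (3 * R') +
        (R' * (√N / (1 - σ)) * P + R' * (√N / κ) * T) +
        7 * R' * √(α * τ / dmin) + 7 * R' * √(α * τ / dmin) * (dmax / κ) +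
        14 * (R' * (α * τ / κ)) + R' * (2 * (α * √N / (κ * (1 - σ)))) := by ring
  rw [e11, e10]
  have huk := huU k
  linarith

end Expectation

/-! ### Comparison with the stated error terms. -/

theorem rpow_five_halves {x : ℝ} (hx : 0 ≤ x) : x ^ (5 / 2 : ℝ) = √x ^ 5 := by
  rw [Real.sqrt_eq_rpow, ← Real.rpow_natCast, ← Real.rpow_mul hx]; norm_num

theorem rpow_three_halves {x : ℝ} (hx : 0 ≤ x) : x ^ (3 / 2 : ℝ) = √x ^ 3 := by
  rw [Real.sqrt_eq_rpow, ← Real.rpow_natCast, ← Real.rpow_mul hx]; norm_num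

/-- The statistical error terms, with the trivial bound used where the step size is large. -/
theorem error_terms_le {E R' t X p bias Y L : ℝ} (hR : 0 ≤ R') (hX : 0 ≤ X)
    (ht : t ≤ 14 * X) (hp : p ≤ X ^ 2) (hbias : 0 ≤ bias) (hY : 0 ≤ Y) (hL : 1 / 2 ≤ L)
    (h1 : E ≤ 2 * R') (h2 : E ≤ bias + R' * (t + 14 * p) + Y) :
    E ≤ bias + 56 * (L * (R' * X)) + Y := by
  have hRX : 0 ≤ R' * X := mul_nonneg hR hX
  have hLX : 1 / 2 * (R' * X) ≤ L * (R' * X) := mul_le_mul_of_nonneg_right hL hRX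
  -- For `X ≥ 1`, `56 L ≥ 28` already covers the trivial bound. For `X ≤ 1`, `X ^ 2 ≤ X` gives `t +
  -- 14 p ≤ 28 X`, and `28 ≤ 56 L`.
  rcases le_total 1 X with h | h
  · have : R' * 1 ≤ R' * X := mul_le_mul_of_nonneg_left h hR
    linarith
  · have h3 : t + 14 * p ≤ 28 * X := by nlinarith
    have := mul_le_mul_of_nonneg_left h3 hR
    linarith

end DistQ

theorem mainTheorem3 :
    ∃ C : ℝ, 0 < C ∧ ∃ B : ℕ → ℕ → ℕ → ℝ → ℝ → ℝ → ℝ → ℝ,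
    ∀ (N : ℕ) (S A : Type*) [Fintype S] [Fintype A] [Nonempty S] [Nonempty A]
      [DecidableEq S] [DecidableEq A]
      (M : DistQ.MAMDP N S A) (Rmax : ℝ) (_ : ∀ i s a s', |M.r i s a s'| ≤ Rmax)
      (W : Matrix (Fin N) (Fin N) ℝ) (_ : W ∈ doublyStochastic ℝ (Fin N))
      (_ : (DistQ.commGraph W).Connected)
      (β : S → A → ℝ) (_ : DistQ.IsPolicy β)
      (d : S × A → ℝ) (_ : DistQ.IsPosStationary (DistQ.saMatrix M β) d)
      (α : ℝ) (τ : ℕ) (_ : 0 < α) (_ : 1 ≤ τ)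
      (_ : DistQ.MixedAt (DistQ.saMatrix M β) d α τ)
      (_ : α ≤ min (⨅ i, W i i) (1 / (2 * (τ : ℝ))))
      (Ω : Type*) (m : MeasurableSpace Ω) (μ : MeasureTheory.Measure Ω)
      [MeasureTheory.IsProbabilityMeasure μ] (ℱ : MeasureTheory.Filtration ℕ m)
      (X : ℕ → Ω → S × A) (_ : DistQ.IsMarkovChain μ ℱ (DistQ.saMatrix M β) X)
      (Q₀ : Ω → Fin N → S × A → ℝ) (_ : ∀ i x, Measurable[ℱ 0] fun ω => Q₀ ω i x)
      (_ : ∀ ω i x, |Q₀ ω i x| ≤ Rmax / (1 - M.γ))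
      (k : ℕ) (_ : τ ≤ k),
      let err : Ω → ℝ := fun ω =>
        ‖DistQ.avg (DistQ.qIter M W α (Q₀ ω) (fun t => X t ω) k) - DistQ.optimalQ M‖
      let dmin : ℝ := ⨅ x, d x
      let dmax : ℝ := ⨆ x, d x
      let σ₂ : ℝ := DistQ.sigma2 W
      let nS : ℕ := Fintype.card S
      let nA : ℕ := Fintype.card A
      MeasureTheory.Integrable err μ ∧
      ∫ ω, err ω ∂μ ≤
        B N nS nA M.γ Rmax dmin σ₂ *
          ((1 - α * (1 - M.γ) * dmin) ^ (((k : ℝ) - τ) / 2) + σ₂ ^ (((k : ℝ) - τ) / 4)) +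
        C * (√(Real.log (2 * τ * nS * nA)) *
              (α ^ (1 / 2 : ℝ) * dmax * (√τ * Rmax) /
                ((1 - M.γ) ^ (5 / 2 : ℝ) * dmin ^ (3 / 2 : ℝ))) +
            α * (Rmax * dmax * √(N * nS * nA)) /
              ((1 - M.γ) ^ 3 * dmin ^ 2 * (1 - σ₂))) := by
  -- `56` comes from `error_terms_le`; `B` is the coefficient of the bias in
  -- `integral_norm_error_le`.
  refine ⟨56, by norm_num, fun N _ _ γ R dmin σ =>
    R / (1 - γ) * (3 + √N / (1 - σ) + √N / ((1 - γ) * dmin)), ?_⟩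
  intro N S A _ _ _ _ _ _ M Rmax hr W hW hconn β hβ d hd α τ hα hτ hmix hαmin Ω m μ _ ℱ X hX Q₀
    hQ₀m hQ₀R k hk err dmin dmax σ₂ nS nA
  have hne : Nonempty (Fin N) := hconn.nonempty
  obtain ⟨i₀⟩ := hne
  have hN : N ≠ 0 := fun h => by subst h; exact i₀.elim0
  obtain ⟨s₀⟩ := ‹Nonempty S›
  obtain ⟨a₀⟩ := ‹Nonempty A›
  have : Nonempty A := ⟨a₀⟩
  have : Nonempty (S × A) := ⟨(s₀, a₀)⟩
  have hR : 0 ≤ Rmax := (abs_nonneg _).trans (hr i₀ s₀ a₀ s₀)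
  have h1γ : 0 < 1 - M.γ := by linarith [M.γ_lt_one]
  have h1γ' : 1 - M.γ ≤ 1 := by linarith [M.γ_nonneg]
  have hτ1 : (1 : ℝ) ≤ τ := by exact_mod_cast hτ
  have hαW : ∀ i, α ≤ W i i := fun i => (hαmin.trans (min_le_left _ _)).trans
    (ciInf_le (Set.finite_range _).bddBelow i)
  have hατ : α * τ ≤ 1 / 2 := by
    have h := hαmin.trans (min_le_right _ _)
    rw [le_div_iff₀ (by positivity)] at h
    linarith
  have hα1 : α ≤ 1 := by
    have : α * 1 ≤ α * τ := mul_le_mul_of_nonneg_left hτ1 hα.le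
    linarith
  obtain ⟨hσ1, hσ⟩ := DistQ.sigma2_spec hW hconn fun i => hα.trans_le (hαW i)
  have hσ0 : 0 ≤ σ₂ := DistQ.sigma2_nonneg W
  have h1σ : 0 < 1 - σ₂ := sub_pos.2 hσ1
  have hd0 : ∀ x, 0 ≤ d x := fun x => (hd.pos x).le
  have hd1 : ∀ x, d x ≤ 1 := fun x => hd.sum_eq_one ▸
    Finset.single_le_sum (fun y _ => hd0 y) (Finset.mem_univ x)
  have hdmin : ∀ x, dmin ≤ d x := ciInf_le (Set.finite_range _).bddBelow
  have hdmax : ∀ x, d x ≤ dmax := le_ciSup (Set.finite_range _).bddAbove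
  have hdmin0 : 0 < dmin := by
    obtain ⟨x, hx⟩ := exists_eq_ciInf_of_finite (f := d)
    exact (hd.pos x).trans_eq hx
  have hle : dmin ≤ dmax := (hdmin (s₀, a₀)).trans (hdmax _)
  have hdmax0 : 0 < dmax := hdmin0.trans_le hle
  have hdmin1 : dmin ≤ 1 := (hdmin (s₀, a₀)).trans (hd1 _)
  have hQ₀B : ∀ i x, DistQ.BddMeas (ℱ 0) fun ω => Q₀ ω i x := fun i x =>
    ⟨hQ₀m i x, _, fun ω => hQ₀R ω i x⟩
  have hEB : DistQ.BddMeas m err := DistQ.BddMeas.norm fun y => DistQ.BddMeas.sub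
    ((DistQ.BddMeas.avg fun i => DistQ.BddMeas.qIter hX M W α hQ₀B k i y).mono (ℱ.le k))
    (DistQ.BddMeas.const _)
  refine ⟨hEB.integrable, ?_⟩
  set R' := Rmax / (1 - M.γ) with hR'
  have hR0 : 0 ≤ R' := div_nonneg hR h1γ.le
  have htriv : ∫ ω, err ω ∂μ ≤ 2 * R' := by
    refine (MeasureTheory.integral_mono (g := fun _ => 2 * R') hEB.integrable
      (MeasureTheory.integrable_const _) fun ω => ?_).trans (by simp)
    refine (pi_norm_le_iff_of_nonneg (by positivity)).2 fun y => ?_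
    have h1 := DistQ.abs_avg_le hN _ _ y fun i =>
      DistQ.abs_qIter_le M hr hW hα.le hαW (Q₀ ω) (hQ₀R ω) (fun t => X t ω) k i y
    have h2 := DistQ.abs_optimalQ_le M hN hR hr y
    rw [Real.norm_eq_abs, Pi.sub_apply]
    exact (abs_sub _ _).trans (by linarith)
  have hmain := DistQ.integral_norm_error_le M hN hR hr hβ hX hd0 hd1 hd.sum_eq_one hdmin0 hdmin
    hdmax hW hσ1 hσ hα.le hα1 hαW hτ hατ hmix hQ₀B hQ₀R hk
  set bias := R' * (3 + √N / (1 - σ₂) + √N / ((1 - M.γ) * dmin)) *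
    ((1 - α * (1 - M.γ) * dmin) ^ (((k : ℝ) - τ) / 2) + σ₂ ^ (((k : ℝ) - τ) / 4)) with hbias
  have hρ0 : 0 ≤ 1 - α * (1 - M.γ) * dmin := by
    have := mul_le_one₀ (mul_le_one₀ hα1 h1γ.le h1γ') hdmin0.le hdmin1
    linarith
  have hbias0 : 0 ≤ bias := by
    have h1 := Real.rpow_nonneg hρ0 (((k : ℝ) - τ) / 2)
    have h2 := Real.rpow_nonneg hσ0 (((k : ℝ) - τ) / 4)
    positivity
  set g := √(1 - M.γ) with hg
  set e := √dmin with he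
  have hg0 : 0 < g := Real.sqrt_pos.2 h1γ
  have he0 : 0 < e := Real.sqrt_pos.2 hdmin0
  have hg1 : g ≤ 1 := Real.sqrt_le_one.2 h1γ'
  have he1 : e ≤ 1 := Real.sqrt_le_one.2 hdmin1
  have hg2 : g ^ 2 = 1 - M.γ := Real.sq_sqrt h1γ.le
  have he2 : e ^ 2 = dmin := Real.sq_sqrt hdmin0.le
  set t := √(α * τ) with ht
  have ht0 : 0 ≤ t := Real.sqrt_nonneg _
  have ht2 : t ^ 2 = α * τ := Real.sq_sqrt (by positivity)
  set T := t * dmax / (g ^ 3 * e ^ 3) with hT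
  have hT0 : 0 ≤ T := by positivity
  -- The argument is at least `2`, and `log 2 > 1 / 4`.
  have hL : 1 / 2 ≤ √(Real.log (2 * τ * nS * nA)) := by
    have hS : (1 : ℝ) ≤ nS := by exact_mod_cast Fintype.card_pos_iff.2 ⟨s₀⟩
    have hA : (1 : ℝ) ≤ nA := by exact_mod_cast Fintype.card_pos_iff.2 ⟨a₀⟩
    refine Real.le_sqrt_of_sq_le ?_
    have h2 : (2 : ℝ) ≤ 2 * τ * nS * nA := by
      have h3 := one_le_mul_of_one_le_of_one_le (one_le_mul_of_one_le_of_one_le hτ1 hS) hA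
      linarith
    have h3 := Real.log_le_log (by norm_num) h2
    have h4 := Real.log_two_gt_d9
    norm_num at *
    linarith
  -- Both summands are at most `7 T`: the first through `dmin ≤ dmax`, the second with a factor `√(1
  -- - γ)` to spare.
  have hstat : 7 * √(α * τ / dmin) * (1 + dmax / ((1 - M.γ) * dmin)) ≤ 14 * T := by
    rw [Real.sqrt_div (by positivity), ← ht, ← he, ← hg2, ← he2]
    have hde : e ^ 2 ≤ dmax := he2.trans_le hle
    have h1 : t / e ≤ T := by
      rw [hT, div_le_div_iff₀ he0 (by positivity)]
      have : g ^ 3 ≤ 1 := pow_le_one₀ hg0.le hg1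
      calc t * (g ^ 3 * e ^ 3) ≤ t * (1 * e ^ 3) := by gcongr
        _ = t * e ^ 2 * e := by ring
        _ ≤ t * dmax * e := by gcongr
    have h2 : t / e * (dmax / (g ^ 2 * e ^ 2)) ≤ T := by
      rw [hT, div_mul_div_comm]
      refine div_le_div_of_nonneg_left (by positivity) (by positivity) ?_
      calc g ^ 3 * e ^ 3 = g * (g ^ 2 * e ^ 3) := by ring
        _ ≤ 1 * (g ^ 2 * e ^ 3) := by gcongr
        _ = e * (g ^ 2 * e ^ 2) := by ring
    linarith
  have hsq : α * τ / ((1 - M.γ) * dmin) ≤ T ^ 2 := by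
    rw [hT, div_pow, mul_pow, ht2, mul_pow, ← pow_mul, ← pow_mul, ← hg2, ← he2,
      div_le_div_iff₀ (by positivity) (by positivity)]
    have hde : e ^ 2 ≤ dmax := he2.trans_le hle
    have h1 : g ^ 4 ≤ 1 := pow_le_one₀ hg0.le hg1
    calc α * τ * (g ^ (3 * 2) * e ^ (3 * 2)) = α * τ * (e ^ 2) ^ 2 * (g ^ 4 * (g ^ 2 * e ^ 2)) := by
          ring
      _ ≤ α * τ * dmax ^ 2 * (1 * (g ^ 2 * e ^ 2)) := by gcongr
      _ = _ := by ring
  -- Only `(1 - γ) dmin ≤ dmax` and `N ≤ N * nS * nA` are needed.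
  have hcons : R' * (2 * (α * √N / ((1 - M.γ) * dmin * (1 - σ₂)))) ≤
      56 * (α * (Rmax * dmax * √(N * nS * nA)) / ((1 - M.γ) ^ 3 * dmin ^ 2 * (1 - σ₂))) := by
    have hNn : √(N : ℝ) ≤ √((N : ℝ) * nS * nA) := by
      refine Real.sqrt_le_sqrt ?_
      have hS : (1 : ℝ) ≤ nS := by exact_mod_cast Fintype.card_pos_iff.2 ⟨s₀⟩
      have hA : (1 : ℝ) ≤ nA := by exact_mod_cast Fintype.card_pos_iff.2 ⟨a₀⟩
      rw [mul_assoc]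
      exact le_mul_of_one_le_right (Nat.cast_nonneg _) (one_le_mul_of_one_le_of_one_le hS hA)
    calc R' * (2 * (α * √N / ((1 - M.γ) * dmin * (1 - σ₂))))
        = 2 * (α * (Rmax * ((1 - M.γ) * dmin) * √N) /
            ((1 - M.γ) ^ 3 * dmin ^ 2 * (1 - σ₂))) := by
          rw [hR']; field_simp
      _ ≤ 56 * (α * (Rmax * (1 * dmax) * √(N * nS * nA)) /
            ((1 - M.γ) ^ 3 * dmin ^ 2 * (1 - σ₂))) := by
          gcongr
          norm_num
      _ = _ := by rw [one_mul]
  have hfirst : α ^ (1 / 2 : ℝ) * dmax * (√τ * Rmax) /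
      ((1 - M.γ) ^ (5 / 2 : ℝ) * dmin ^ (3 / 2 : ℝ)) = R' * T := by
    rw [DistQ.rpow_five_halves h1γ.le, DistQ.rpow_three_halves hdmin0.le, ← Real.sqrt_eq_rpow,
      ← hg, ← he, hR', hT, ht, Real.sqrt_mul hα.le, ← hg2]
    field_simp
  have hfin := DistQ.error_terms_le (E := ∫ ω, err ω ∂μ) hR0 hT0 hstat hsq hbias0
    (by positivity : 0 ≤ R' * (2 * (α * √N / ((1 - M.γ) * dmin * (1 - σ₂))))) hL htriv
    (hmain.trans (le_of_eq (by ring)))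
  rw [hfirst]
  refine hfin.trans ?_
  linarith
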